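/- For an integer $n\ge 0$ put $(a;q)_n:=\prod_{j=0}^{n-1}(1-aq^j)$, with the convention $1/(q;q)_n:=0$ for $n<0$, and let $$\binom{n}{m}_q:=\frac{(q;q)_n}{(q;q)_m(q;q)_{n-m}}\ \text{ if } 0\le m\le n,\qquad \binom{n}{m}_q:=0\ \text{ otherwise.}$$ For integers $k\ge 1$ and $N\ge 0$ define, with $s_0:=0$, $$\mathcal Z_k(N;t,q):=\sum_{\substack{r_k\ge\cdots\ge r_1\ge 0\\ s_k\ge\cdots\ge s_1\ge 0}}\frac{t^{\sum_{i=1}^k(2r_i-s_i)}\,q^{\sum_{i=1}^k(r_i^2-r_is_i+s_i^2)}}{(q;q)_{N-r_k}\left(\prod_{i=2}^k(q;q)_{r_i-r_{i-1}}\right)(tq;q)_{r_1}^2\,(q;q)_{s_1}}\prod_{i=1}^k\binom{r_i-s_{i-1}}{r_i-s_i}_q ,$$ a sum with only finitely many nonzero terms. **Theorem.** Let $k\ge 1$ and $N\ge 0$ be integers and let $t,q$ be nonzero elements of a field such that $q^j\ne 1$ for $1\le j\le N$ and $tq^j\neq 1$ for $0\le j\le N$ (so that no denominator below vanishes). Then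 $$\mathcal Z_k(N;t,q)=\frac{(1-t)^2q^N\,(t^{2N}q^{N^2})^{k-1}}{(1-tq^N)^2}\;\mathcal Z_k(N;t^{-1}q^{-N},q).$$ In particular, this holds as an identity of rational functions in the indeterminates $t$ and $q$. -/

import Mathlib

/-- The `q`-Pochhammer symbol `(a;q)_n = ∏_{j=0}^{n-1} (1 - a q^j)` for a natural number `n`. -/
def qPoch {K : Type*} [Field K] (a q : K) (n : ℕ) : K :=
  ∏ j ∈ Finset.range n, (1 - a * q ^ j)

/-- The reciprocal `1/(q;q)_n` for an integer `n`, with the usual convention that it is `0`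
for negative `n`. -/
noncomputable def recipPoch {K : Type*} [Field K] (q : K) (n : ℤ) : K :=
  if 0 ≤ n then 1 / qPoch q q n.toNat else 0

/-- The `q`-binomial coefficient, equal to `(q;q)_n / ((q;q)_m (q;q)_{n-m})` if `0 ≤ m ≤ n`
and to `0` otherwise. -/
noncomputable def qBinom {K : Type*} [Field K] (q : K) (n m : ℤ) : K :=
  if 0 ≤ m ∧ m ≤ n then
    qPoch q q n.toNat / (qPoch q q m.toNat * qPoch q q (n - m).toNat)
  else 0

/-- The entry `x_i` of a weakly increasing sequence `x = (x_1, …, x_k)`, as an integer,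
with the convention `x_0 = 0`. -/
def entry {k : ℕ} (x : Fin k →o ℕ) (i : ℕ) : ℤ :=
  if h : 1 ≤ i ∧ i ≤ k then (x ⟨i - 1, by omega⟩ : ℤ) else 0

/-- The summand of `Z_k(N;t,q)` at the weakly increasing sequences `r` and `s`. -/
noncomputable def ZTerm {K : Type*} [Field K] (k N : ℕ) (t q : K) (r s : Fin k →o ℕ) : K :=
  t ^ (∑ i ∈ Finset.Icc 1 k, (2 * entry r i - entry s i))
    * q ^ (∑ i ∈ Finset.Icc 1 k, (entry r i ^ 2 - entry r i * entry s i + entry s i ^ 2))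
    * recipPoch q (N - entry r k)
    * (∏ i ∈ Finset.Icc 2 k, recipPoch q (entry r i - entry r (i - 1)))
    * (1 / qPoch (t * q) q (entry r 1).toNat ^ 2)
    * recipPoch q (entry s 1)
    * ∏ i ∈ Finset.Icc 1 k, qBinom q (entry r i - entry s (i - 1)) (entry r i - entry s i)

/-- `Z_k(N;t,q)`: the sum runs over all pairs of weakly increasing sequences
`0 ≤ r_1 ≤ ⋯ ≤ r_k` and `0 ≤ s_1 ≤ ⋯ ≤ s_k`; only finitely many terms are nonzero,
as shown in `ZTerm_support_finite`. -/
noncomputable def ZSum {K : Type*} [Field K] (k N : ℕ) (t q : K) : K :=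
  ∑ᶠ p : (Fin k →o ℕ) × (Fin k →o ℕ), ZTerm k N t q p.1 p.2

theorem ZTerm_bound {K : Type*} [Field K] (k N : ℕ) (t q : K) (r s : Fin k →o ℕ)
    (h : ZTerm k N t q r s ≠ 0) (i : Fin k) : r i ≤ N ∧ s i ≤ r i := by
  unfold ZTerm at h
  have h1 := right_ne_zero_of_mul h
  have h2 := right_ne_zero_of_mul (left_ne_zero_of_mul (left_ne_zero_of_mul
    (left_ne_zero_of_mul (left_ne_zero_of_mul h))))
  have hi := i.isLt
  constructor
  · have h3 : 0 ≤ (N : ℤ) - entry r k := by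
      by_contra hn
      exact h2 (by simp only [recipPoch, if_neg hn])
    have h4 : entry r k = (r ⟨k - 1, by omega⟩ : ℤ) := by
      unfold entry
      rw [dif_pos ⟨by omega, le_rfl⟩]
    have h5 : r i ≤ r ⟨k - 1, by omega⟩ := r.monotone (by
      rw [Fin.le_def]
      change (i : ℕ) ≤ k - 1
      omega)
    omega
  · have h3 := Finset.prod_ne_zero_iff.mp h1 (i + 1) (Finset.mem_Icc.mpr (by omega))
    have h4 : 0 ≤ entry r (i + 1) - entry s (i + 1) := by
      by_contra hn
      exact h3 (by
        unfold qBinom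
        exact if_neg (fun hh => hn hh.1))
    have h5 : ∀ x : Fin k →o ℕ, entry x (i + 1) = (x i : ℤ) := by
      intro x
      unfold entry
      rw [dif_pos ⟨by omega, by omega⟩]
      rfl
    rw [h5, h5] at h4
    omega

theorem ZTerm_support_finite {K : Type*} [Field K] (k N : ℕ) (t q : K) :
    (Function.support fun p : (Fin k →o ℕ) × (Fin k →o ℕ) => ZTerm k N t q p.1 p.2).Finite := by
  have hf := (Set.finite_Iic (fun _ : Fin k => N)).prod (Set.finite_Iic (fun _ : Fin k => N))
  have hinj : Function.Injective
      (fun p : (Fin k →o ℕ) × (Fin k →o ℕ) => ((⇑p.1, ⇑p.2) : (Fin k → ℕ) × (Fin k → ℕ))) := by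
    intro p p' h
    rw [Prod.mk.injEq] at h
    exact Prod.ext (DFunLike.coe_injective h.1) (DFunLike.coe_injective h.2)
  refine (hf.preimage hinj.injOn).subset ?_
  intro p hp
  have hb := ZTerm_bound k N t q p.1 p.2 hp
  exact ⟨fun i => (hb i).1, fun i => (hb i).2.trans (hb i).1⟩

/-! Write t' = t⁻¹q^(-N) and c = t^(2N) q^(N²). The rank-two sum collapses to a rank-one one: for k
≥ 1 it is the k-th iterate of a Bailey chain, divided by (tq;q)_N (`ZSum_succ`), and the symmetry is
then proved for the simpler chain (`baileyIter_reflect_self`). Both halves use one mechanism. A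
matrix that intertwines single steps of two chains and matches their initial vectors also matches
all iterates; at the extreme index its triangular shape leaves only one term.

Collapse: `chainVec` records the rank-two sum with its last entries r, s fixed, and `chainKernel`
carries the rank-one chain to it (`chainVec_eq_sum`). In the intertwining relation
`sum_sum_chainKernel` the weight times the kernel splits into a factor in s' and a factor in r', so
the double sum is a product of two single sums. What remains is a symmetry between n and r - s
(`chainKernel_symm_sum`). At r = s = N only n = N survives.

Reflection: `reflKernel` carries the chain of t' to that of t, each step costing a factor c
(`reflKernel_intertwine`). The two matrix products are values of `reflSum` at (n, m) and at (N - m,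
N - n), and these agree. At n = N only the diagonal entry c⁻¹ survives, which explains the exponent
k - 1. The other prefactors come from matching initial vectors (`baileyIter_zero_reflect`) and from
reversing (t'q;q)_N.

The summations needed are the `q`-binomial theorem and variants of `q`-Chu–Vandermonde, all proved
by induction with the two `q`-Pascal rules. -/

/-- The Gaussian binomial coefficient, defined by the `q`-Pascal recursion. -/
def gaussBinom {K : Type*} [Field K] (q : K) : ℕ → ℕ → K
  | _, 0 => 1
  | 0, _ + 1 => 0
  | n + 1, m + 1 => gaussBinom q n m + q ^ (m + 1) * gaussBinom q n (m + 1)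

/-! ### Gaussian binomials and single-sum evaluations -/

section Basic

variable {K : Type*} [Field K]

theorem qPoch_zero (a q : K) : qPoch a q 0 = 1 := by simp [qPoch]

theorem qPoch_succ (a q : K) (n : ℕ) : qPoch a q (n + 1) = qPoch a q n * (1 - a * q ^ n) := by
  simp [qPoch, Finset.prod_range_succ]

theorem qPoch_add (a q : K) (m n : ℕ) :
    qPoch a q (m + n) = qPoch a q m * qPoch (a * q ^ m) q n := by
  simp only [qPoch, Finset.prod_range_add, pow_add, mul_assoc]

theorem qPoch_succ_left (a q : K) (n : ℕ) :
    qPoch a q (n + 1) = (1 - a) * qPoch (a * q) q n := by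
  rw [add_comm, qPoch_add, pow_one, qPoch_succ, qPoch_zero]; simp

theorem qPoch_ne_zero {a q : K} {n : ℕ} (h : ∀ j, j < n → a * q ^ j ≠ 1) : qPoch a q n ≠ 0 := by
  rw [qPoch, Finset.prod_ne_zero_iff]
  intro j hj
  exact sub_ne_zero.mpr (h j (Finset.mem_range.mp hj)).symm

@[simp] theorem gaussBinom_zero_right (q : K) (n : ℕ) : gaussBinom q n 0 = 1 := by
  cases n <;> rfl

@[simp] theorem gaussBinom_zero_succ (q : K) (m : ℕ) : gaussBinom q 0 (m + 1) = 0 := rfl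

theorem gaussBinom_succ_succ (q : K) (n m : ℕ) : gaussBinom q (n + 1) (m + 1) =
    gaussBinom q n m + q ^ (m + 1) * gaussBinom q n (m + 1) := rfl

theorem gaussBinom_eq_zero (q : K) {n m : ℕ} (h : n < m) : gaussBinom q n m = 0 := by
  induction n generalizing m with
  | zero => cases m with
    | zero => omega
    | succ m => rfl
  | succ n ih => cases m with
    | zero => omega
    | succ m => rw [gaussBinom_succ_succ, ih (by omega), ih (by omega)]; simp

@[simp] theorem gaussBinom_self (q : K) (n : ℕ) : gaussBinom q n n = 1 := by
  induction n with
  | zero => rfl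
  | succ n ih => rw [gaussBinom_succ_succ, ih, gaussBinom_eq_zero q (Nat.lt_succ_self n)]; simp

/-- The second `q`-Pascal rule. The truncated exponent is harmless, since the binomial beside it
vanishes for m > n. -/
theorem gaussBinom_succ_succ' (q : K) (n m : ℕ) : gaussBinom q (n + 1) (m + 1) =
    q ^ (n - m) * gaussBinom q n m + gaussBinom q n (m + 1) := by
  induction n generalizing m with
  | zero =>
    cases m with
    | zero => simp
    | succ m => simp [gaussBinom_succ_succ]
  | succ n ih =>
    rcases lt_or_ge n m with h | h
    · rcases Nat.lt_or_ge (n + 1) m with h' | h'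
      · rw [gaussBinom_eq_zero q (by omega), gaussBinom_eq_zero q (by omega),
          gaussBinom_eq_zero q (by omega)]; simp
      · obtain rfl : m = n + 1 := by omega
        rw [gaussBinom_self, gaussBinom_self, gaussBinom_eq_zero q (by omega)]; simp
    · cases m with
      | zero =>
        have e1 := ih 0
        have e2 := gaussBinom_succ_succ q n 0
        have e3 := gaussBinom_succ_succ q (n + 1) 0
        simp only [gaussBinom_zero_right, Nat.sub_zero] at *
        linear_combination e3 + q * e1 - e2
      | succ m =>
        have e1 := ih m
        have e2 := ih (m + 1)
        have e3 := gaussBinom_succ_succ q n m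
        have e4 := gaussBinom_succ_succ q n (m + 1)
        have e5 := gaussBinom_succ_succ q (n + 1) (m + 1)
        obtain ⟨d, rfl⟩ := Nat.exists_eq_add_of_le h
        rw [show m + 1 + d - m = d + 1 by omega] at e1
        rw [show m + 1 + d - (m + 1) = d by omega] at e2
        rw [show m + 1 + d + 1 - (m + 1) = d + 1 by omega]
        linear_combination e5 + e1 + q ^ (m + 1 + 1) * e2 - q ^ (d + 1) * e3 - e4

/-- The division-free form needs no nonvanishing hypothesis, so it also holds when `q` is a root of
unity. -/
theorem gaussBinom_mul_qPoch (q : K) (m d : ℕ) :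
    gaussBinom q (m + d) m * (qPoch q q m * qPoch q q d) = qPoch q q (m + d) := by
  induction d generalizing m with
  | zero => simp [qPoch_zero]
  | succ d ih =>
    induction m with
    | zero => simp [qPoch_zero]
    | succ m ih' =>
      have e1 := ih (m + 1)
      rw [show m + (d + 1) = m + 1 + d by ring] at ih'
      rw [show m + 1 + (d + 1) = (m + 1 + d) + 1 by ring, gaussBinom_succ_succ,
        qPoch_succ q q (m + 1 + d)]
      rw [qPoch_succ q q m, qPoch_succ q q d] at *
      have : q * q ^ (m + 1 + d) = q ^ (m + 1) * (q * q ^ d) := by ring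
      rw [this]
      linear_combination (1 - q * q ^ m) * ih' + q ^ (m + 1) * (1 - q * q ^ d) * e1

theorem gaussBinom_symm (q : K) (m d : ℕ) :
    gaussBinom q (m + d) m = gaussBinom q (m + d) d := by
  induction d generalizing m with
  | zero => simp
  | succ d ih =>
    induction m with
    | zero => simp
    | succ m ih' =>
      rw [show m + 1 + (d + 1) = (m + 1 + d) + 1 by ring, gaussBinom_succ_succ,
        gaussBinom_succ_succ', ih (m + 1), show m + 1 + d = m + (d + 1) by ring, ih',
        show m + (d + 1) - d = m + 1 by omega]
      ring

theorem gaussBinom_eq_div (q : K) {m d : ℕ} (h : qPoch q q (m + d) ≠ 0) :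
    gaussBinom q (m + d) m = qPoch q q (m + d) / (qPoch q q m * qPoch q q d) := by
  rw [← gaussBinom_mul_qPoch q m d] at h ⊢
  rw [mul_div_cancel_right₀ _ (right_ne_zero_of_mul h)]

/-- Both products are the `q`-trinomial coefficient with parts i, l, d. -/
theorem gaussBinom_mul_gaussBinom (q : K) {i l d : ℕ} (h : qPoch q q (i + l + d) ≠ 0) :
    gaussBinom q (i + l + d) i * gaussBinom q (l + d) l =
      gaussBinom q (i + l + d) l * gaussBinom q (i + d) i := by
  have e1 := gaussBinom_mul_qPoch q i (l + d)
  have e2 := gaussBinom_mul_qPoch q l d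
  have e3 := gaussBinom_mul_qPoch q l (i + d)
  have e4 := gaussBinom_mul_qPoch q i d
  rw [← add_assoc] at e1
  rw [← add_assoc, add_comm l i] at e3
  have h1 : qPoch q q i ≠ 0 := fun h0 => h (by rw [← e1, h0]; ring)
  have h2 : qPoch q q l ≠ 0 := fun h0 => h (by rw [← e3, h0]; ring)
  have h3 : qPoch q q d ≠ 0 := fun h0 => h (by rw [← e1, ← e2, h0]; ring)
  have h4 : qPoch q q i * qPoch q q l * qPoch q q d ≠ 0 := mul_ne_zero (mul_ne_zero h1 h2) h3
  rw [← mul_left_inj' h4]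
  rw [← e2] at e1
  rw [← e4] at e3
  linear_combination e1 - e3

/-- The finite `q`-binomial theorem. -/
theorem qPoch_eq_sum (x q : K) (n : ℕ) : qPoch x q n =
    ∑ l ∈ Finset.range (n + 1), (-1) ^ l * q ^ l.choose 2 * gaussBinom q n l * x ^ l := by
  induction n generalizing x with
  | zero => simp [qPoch_zero]
  | succ n ih =>
    rw [qPoch_succ_left, ih, Finset.sum_range_succ' _ (n + 1)]
    simp only [gaussBinom_succ_succ, mul_add, add_mul, Finset.sum_add_distrib]
    have e1 : ∑ l ∈ Finset.range (n + 1), (-1) ^ (l + 1) * q ^ (l + 1).choose 2 *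
        gaussBinom q n l * x ^ (l + 1) = - x * ∑ l ∈ Finset.range (n + 1),
        (-1) ^ l * q ^ l.choose 2 * gaussBinom q n l * (x * q) ^ l := by
      rw [Finset.mul_sum]
      refine Finset.sum_congr rfl fun l _ => ?_
      rw [Nat.choose_succ_succ' l 1, Nat.choose_one_right]
      ring
    have e2 : ∑ l ∈ Finset.range (n + 1), (-1) ^ l * q ^ l.choose 2 *
        gaussBinom q n l * (x * q) ^ l = 1 + ∑ l ∈ Finset.range (n + 1), (-1) ^ (l + 1) *
        q ^ (l + 1).choose 2 * (q ^ (l + 1) * gaussBinom q n (l + 1)) * x ^ (l + 1) := by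
      rw [Finset.sum_range_succ', Finset.sum_range_succ _ n, gaussBinom_eq_zero q n.lt_succ_self]
      simp only [pow_zero, Nat.choose_zero_succ, gaussBinom_zero_right, mul_zero, zero_mul,
        add_zero, mul_one]
      rw [add_comm]
      congr 1
      refine Finset.sum_congr rfl fun l _ => ?_
      ring
    rw [e1]
    simp only [pow_zero, Nat.choose_zero_succ, gaussBinom_zero_right, mul_one]
    linear_combination e2

/-- A p-fold `q`-difference of a binomial: each application of Pascal replaces a difference of
neighbouring binomials by one binomial and a power of `q`. -/
theorem sum_gaussBinom_mul_gaussBinom_sub (q : K) (c p n : ℕ) (h : n ≤ p + c) :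
    ∑ i ∈ Finset.range (p + 1), (-1) ^ i * q ^ i.choose 2 * gaussBinom q p i *
      gaussBinom q (p + c - i) (p + c - n) = q ^ (p * n) * gaussBinom q c n := by
  induction p with
  | zero =>
    obtain ⟨d, hd⟩ := Nat.exists_eq_add_of_le h
    simp only [zero_add] at hd
    subst hd
    simpa using (gaussBinom_symm q n d).symm
  | succ p ih =>
    -- In the extreme case n = p + 1 + c the lower index is 0, both binomials are 1, and the
    -- difference is 0.
    have key : ∀ i ∈ Finset.range (p + 1), gaussBinom q p i * (gaussBinom q (p + 1 + c - i)
        (p + 1 + c - n) - gaussBinom q (p + c - i) (p + 1 + c - n)) * q ^ i =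
        if n ≤ p + c then q ^ n * gaussBinom q p i * gaussBinom q (p + c - i) (p + c - n)
        else 0 := by
      intro i hi
      have hi' : i ≤ p := Nat.lt_succ_iff.mp (Finset.mem_range.mp hi)
      split_ifs with hn
      · obtain ⟨d, hd⟩ := Nat.exists_eq_add_of_le hn
        rw [show p + 1 + c - n = d + 1 by omega, show p + c - n = d by omega,
          show p + 1 + c - i = (p + c - i) + 1 by omega, gaussBinom_succ_succ']
        rcases le_or_gt i n with hin | hin
        · obtain ⟨e, rfl⟩ := Nat.exists_eq_add_of_le hin
          rw [show p + c - i - d = e by omega]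
          ring
        · rw [gaussBinom_eq_zero q (show p + c - i < d by omega)]
          ring
      · rw [show p + 1 + c - n = 0 by omega]
        simp
    have e1 : ∑ i ∈ Finset.range (p + 1 + 1), (-1) ^ i * q ^ i.choose 2 * gaussBinom q (p + 1) i *
        gaussBinom q (p + 1 + c - i) (p + 1 + c - n) = ∑ i ∈ Finset.range (p + 1),
        (-1) ^ i * q ^ i.choose 2 * (gaussBinom q p i * (gaussBinom q (p + 1 + c - i)
        (p + 1 + c - n) - gaussBinom q (p + c - i) (p + 1 + c - n)) * q ^ i) := by
      rw [Finset.sum_range_succ']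
      simp only [gaussBinom_succ_succ, mul_add, add_mul, mul_sub, sub_mul, Finset.sum_add_distrib,
        Finset.sum_sub_distrib]
      have e2 : ∑ i ∈ Finset.range (p + 1), (-1) ^ i * (q ^ i.choose 2 * (gaussBinom q p i *
          gaussBinom q (p + 1 + c - i) (p + 1 + c - n) * q ^ i)) =
          ∑ i ∈ Finset.range (p + 1), (-1) ^ (i + 1) * q ^ (i + 1).choose 2 *
          (q ^ (i + 1) * gaussBinom q p (i + 1)) *
          gaussBinom q (p + 1 + c - (i + 1)) (p + 1 + c - n) +
          gaussBinom q (p + 1 + c) (p + 1 + c - n) := by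
        rw [Finset.sum_range_succ', Finset.sum_range_succ _ p,
          gaussBinom_eq_zero q p.lt_succ_self]
        simp only [mul_zero, zero_mul, add_zero, pow_zero, Nat.choose_zero_succ,
          gaussBinom_zero_right, one_mul, mul_one, Nat.sub_zero]
        congr 1
        refine Finset.sum_congr rfl fun l _ => ?_
        ring
      have e3 : ∑ i ∈ Finset.range (p + 1), (-1) ^ i * (q ^ i.choose 2 * (gaussBinom q p i *
          gaussBinom q (p + c - i) (p + 1 + c - n) * q ^ i)) =
          - ∑ i ∈ Finset.range (p + 1), (-1) ^ (i + 1) * q ^ (i + 1).choose 2 *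
          gaussBinom q p i * gaussBinom q (p + 1 + c - (i + 1)) (p + 1 + c - n) := by
        rw [← Finset.sum_neg_distrib]
        refine Finset.sum_congr rfl fun l _ => ?_
        rw [Nat.choose_succ_succ' l 1, Nat.choose_one_right,
          show p + 1 + c - (l + 1) = p + c - l by omega]
        ring
      simp only [mul_assoc] at e2 e3 ⊢
      rw [e2, e3]
      simp only [pow_zero, Nat.choose_zero_succ, gaussBinom_zero_right, Nat.sub_zero]
      ring
    rw [e1, Finset.sum_congr rfl fun i hi => by rw [key i hi]]
    split_ifs with hn
    · rw [add_mul p 1 n, pow_add, one_mul, mul_comm (q ^ (p * n)), mul_assoc, ← ih hn,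
        Finset.mul_sum]
      refine Finset.sum_congr rfl fun i _ => ?_
      ring
    · rw [gaussBinom_eq_zero q (show c < n by omega)]
      simp

/-- A `q`-Chu–Vandermonde sum. Pascal reduces S + 1 to S at both x and xq, so the induction must
keep x general. It matches the initial vectors under reflection. -/
theorem sum_qPoch_mul_qPoch_mul_pow (x y q : K) (S : ℕ) :
    ∑ e ∈ Finset.range (S + 1), (-1) ^ e * y ^ e * q ^ e.choose 2 * gaussBinom q S e *
      qPoch x q e * qPoch (x * y * q ^ e) q (S - e) = qPoch y q S := by
  induction S generalizing x with
  | zero => simp [qPoch_zero]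
  | succ S ih =>
    have e1 : ∀ e ∈ Finset.range (S + 1), (-1) ^ e * y ^ e * q ^ e.choose 2 * gaussBinom q S e *
        qPoch x q e * qPoch (x * y * q ^ e) q (S + 1 - e) =
        ((-1) ^ e * y ^ e * q ^ e.choose 2 * gaussBinom q S e *
        qPoch x q e * qPoch (x * y * q ^ e) q (S - e)) * (1 - x * y * q ^ S) := by
      intro e he
      have he' : e ≤ S := Nat.lt_succ_iff.mp (Finset.mem_range.mp he)
      obtain ⟨d, rfl⟩ := Nat.exists_eq_add_of_le he'
      rw [show e + d + 1 - e = d + 1 by omega, show e + d - e = d by omega, qPoch_succ]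
      ring
    have e2 : ∀ e ∈ Finset.range (S + 1), (-1) ^ (e + 1) * y ^ (e + 1) * q ^ (e + 1).choose 2 *
        (q ^ (S - e) * gaussBinom q S e) *
        qPoch x q (e + 1) * qPoch (x * y * q ^ (e + 1)) q (S + 1 - (e + 1)) =
        ((-1) ^ e * y ^ e * q ^ e.choose 2 * gaussBinom q S e *
        qPoch (x * q) q e * qPoch (x * q * y * q ^ e) q (S - e)) *
          (- (y * q ^ S * (1 - x))) := by
      intro e he
      have he' : e ≤ S := Nat.lt_succ_iff.mp (Finset.mem_range.mp he)
      obtain ⟨d, rfl⟩ := Nat.exists_eq_add_of_le he'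
      rw [show e + d + 1 - (e + 1) = d by omega, show e + d - e = d by omega, qPoch_succ_left,
        Nat.choose_succ_succ' e 1, Nat.choose_one_right,
        show x * y * q ^ (e + 1) = x * q * y * q ^ e by ring]
      ring
    have e3 : ∑ e ∈ Finset.range (S + 1), (-1) ^ e * y ^ e * q ^ e.choose 2 * gaussBinom q S e *
        qPoch x q e * qPoch (x * y * q ^ e) q (S + 1 - e) =
        ∑ e ∈ Finset.range (S + 1), (-1) ^ (e + 1) * y ^ (e + 1) * q ^ (e + 1).choose 2 *
        gaussBinom q S (e + 1) * qPoch x q (e + 1) *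
        qPoch (x * y * q ^ (e + 1)) q (S + 1 - (e + 1)) + qPoch (x * y) q (S + 1) := by
      rw [Finset.sum_range_succ', Finset.sum_range_succ _ S, gaussBinom_eq_zero q S.lt_succ_self]
      simp [qPoch_zero]
    rw [Finset.sum_range_succ']
    simp only [gaussBinom_succ_succ', mul_add, add_mul, Finset.sum_add_distrib]
    rw [Finset.sum_congr rfl e2, ← Finset.sum_mul, ih (x * q)]
    rw [Finset.sum_congr rfl e1, ← Finset.sum_mul, ih x] at e3
    simp only [pow_zero, Nat.choose_zero_succ, gaussBinom_zero_right, mul_one, Nat.sub_zero,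
      qPoch_zero, one_mul]
    rw [qPoch_succ y]
    linear_combination - e3

/-- Pascal reduces R + 1 to R at (x, y) and at (xq, yq). This evaluates the initial vector of the
rank-two chain. -/
theorem sum_qPoch_mul_qPoch (x y q : K) (R : ℕ) :
    ∑ i ∈ Finset.range (R + 1), (-1) ^ i * q ^ i.choose 2 * gaussBinom q R i *
      qPoch x q (R - i) * qPoch (y * q ^ (R - i)) q i =
      (-1) ^ R * q ^ R.choose 2 * ∏ i ∈ Finset.range R, (x - y * q ^ i) := by
  induction R generalizing x y with
  | zero => simp [qPoch_zero]
  | succ R ih =>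
    have e1 : ∀ i ∈ Finset.range (R + 1), (-1) ^ i * q ^ i.choose 2 * gaussBinom q R i *
        qPoch x q (R + 1 - i) * qPoch (y * q ^ (R + 1 - i)) q i =
        ((-1) ^ i * q ^ i.choose 2 * gaussBinom q R i *
        qPoch (x * q) q (R - i) * qPoch (y * q * q ^ (R - i)) q i) * (1 - x) := by
      intro i hi
      have hi' : i ≤ R := Nat.lt_succ_iff.mp (Finset.mem_range.mp hi)
      obtain ⟨d, rfl⟩ := Nat.exists_eq_add_of_le hi'
      rw [show i + d + 1 - i = d + 1 by omega, show i + d - i = d by omega, qPoch_succ_left,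
        show y * q ^ (d + 1) = y * q * q ^ d by ring]
      ring
    have e2 : ∀ i ∈ Finset.range (R + 1), (-1) ^ (i + 1) * q ^ (i + 1).choose 2 *
        (q ^ (R - i) * gaussBinom q R i) * qPoch x q (R + 1 - (i + 1)) *
        qPoch (y * q ^ (R + 1 - (i + 1))) q (i + 1) =
        ((-1) ^ i * q ^ i.choose 2 * gaussBinom q R i *
        qPoch x q (R - i) * qPoch (y * q ^ (R - i)) q i) * (- (q ^ R * (1 - y * q ^ R))) := by
      intro i hi
      have hi' : i ≤ R := Nat.lt_succ_iff.mp (Finset.mem_range.mp hi)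
      obtain ⟨d, rfl⟩ := Nat.exists_eq_add_of_le hi'
      rw [show i + d + 1 - (i + 1) = d by omega, show i + d - i = d by omega, qPoch_succ,
        Nat.choose_succ_succ' i 1, Nat.choose_one_right]
      ring
    have e3 : ∑ i ∈ Finset.range (R + 1), (-1) ^ i * q ^ i.choose 2 * gaussBinom q R i *
        qPoch x q (R + 1 - i) * qPoch (y * q ^ (R + 1 - i)) q i =
        ∑ i ∈ Finset.range (R + 1), (-1) ^ (i + 1) * q ^ (i + 1).choose 2 *
        gaussBinom q R (i + 1) * qPoch x q (R + 1 - (i + 1)) *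
        qPoch (y * q ^ (R + 1 - (i + 1))) q (i + 1) + qPoch x q (R + 1) := by
      rw [Finset.sum_range_succ', Finset.sum_range_succ _ R, gaussBinom_eq_zero q R.lt_succ_self]
      simp [qPoch_zero]
    have e4 : ∏ i ∈ Finset.range R, (x * q - y * q * q ^ i) =
        q ^ R * ∏ i ∈ Finset.range R, (x - y * q ^ i) := by
      have : ∀ i ∈ Finset.range R, x * q - y * q * q ^ i = q * (x - y * q ^ i) :=
        fun i _ => by ring
      rw [Finset.prod_congr rfl this, Finset.prod_mul_distrib]
      simp
    rw [Finset.sum_range_succ']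
    simp only [gaussBinom_succ_succ', mul_add, add_mul, Finset.sum_add_distrib]
    rw [Finset.sum_congr rfl e2, ← Finset.sum_mul, ih x y]
    rw [Finset.sum_congr rfl e1, ← Finset.sum_mul, ih (x * q) (y * q), e4] at e3
    simp only [pow_zero, Nat.choose_zero_succ, gaussBinom_zero_right, mul_one, Nat.sub_zero,
      qPoch_zero, one_mul]
    rw [Finset.prod_range_succ, Nat.choose_succ_succ' R 1, Nat.choose_one_right]
    linear_combination - e3

/-- A limiting `q`-Chu–Vandermonde sum with denominators cleared; it performs the summation over r'
in the rank-two step. -/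
theorem sum_pow_sq_mul_qPoch (a q : K) (M : ℕ) :
    ∑ i ∈ Finset.range (M + 1), a ^ i * q ^ (i ^ 2) * gaussBinom q M i *
      qPoch (a * q ^ (i + 1)) q (M - i) = 1 := by
  induction M generalizing a with
  | zero => simp [qPoch_zero]
  | succ M ih =>
    have e1 : ∀ i ∈ Finset.range (M + 1), a ^ i * q ^ (i ^ 2) * gaussBinom q M i *
        qPoch (a * q ^ (i + 1)) q (M + 1 - i) = (a ^ i * q ^ (i ^ 2) * gaussBinom q M i *
        qPoch (a * q ^ (i + 1)) q (M - i)) * (1 - a * q ^ (M + 1)) := by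
      intro e he
      have he' : e ≤ M := Nat.lt_succ_iff.mp (Finset.mem_range.mp he)
      obtain ⟨d, rfl⟩ := Nat.exists_eq_add_of_le he'
      rw [show e + d + 1 - e = d + 1 by omega, show e + d - e = d by omega, qPoch_succ]
      ring
    have e2 : ∀ e ∈ Finset.range (M + 1), a ^ (e + 1) * q ^ ((e + 1) ^ 2) *
        (q ^ (M - e) * gaussBinom q M e) *
        qPoch (a * q ^ (e + 1 + 1)) q (M + 1 - (e + 1)) =
        ((a * q) ^ e * q ^ (e ^ 2) * gaussBinom q M e *
        qPoch (a * q * q ^ (e + 1)) q (M - e)) * (a * q ^ (M + 1)) := by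
      intro e he
      have he' : e ≤ M := Nat.lt_succ_iff.mp (Finset.mem_range.mp he)
      obtain ⟨d, rfl⟩ := Nat.exists_eq_add_of_le he'
      rw [show e + d + 1 - (e + 1) = d by omega, show e + d - e = d by omega,
        show a * q ^ (e + 1 + 1) = a * q * q ^ (e + 1) by ring]
      ring
    have e3 : ∑ i ∈ Finset.range (M + 1), a ^ i * q ^ (i ^ 2) * gaussBinom q M i *
        qPoch (a * q ^ (i + 1)) q (M + 1 - i) =
        ∑ i ∈ Finset.range (M + 1), a ^ (i + 1) * q ^ ((i + 1) ^ 2) * gaussBinom q M (i + 1) *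
        qPoch (a * q ^ (i + 1 + 1)) q (M + 1 - (i + 1)) + qPoch (a * q) q (M + 1) := by
      rw [Finset.sum_range_succ', Finset.sum_range_succ _ M, gaussBinom_eq_zero q M.lt_succ_self]
      simp
    rw [Finset.sum_range_succ']
    simp only [gaussBinom_succ_succ', mul_add, add_mul, Finset.sum_add_distrib]
    rw [Finset.sum_congr rfl e2, ← Finset.sum_mul, ih (a * q)]
    rw [Finset.sum_congr rfl e1, ← Finset.sum_mul, ih a] at e3
    simp only [pow_zero, gaussBinom_zero_right, mul_one, Nat.sub_zero, zero_add, pow_one,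
      zero_pow, ne_eq, not_false_eq_true, OfNat.ofNat_ne_zero, one_mul]
    linear_combination - e3

end Basic

/-! ### Transformation of alternating sums and the symmetry of `reflSum` -/

section Transformations

variable {K : Type*} [Field K]

theorem qPoch_ne_zero_of_le {a q : K} {m n : ℕ} (h : qPoch a q n ≠ 0) (hmn : m ≤ n) :
    qPoch a q m ≠ 0 := by
  obtain ⟨d, rfl⟩ := Nat.exists_eq_add_of_le hmn
  rw [qPoch_add] at h
  exact left_ne_zero_of_mul h

theorem gaussBinom_mul_gaussBinom_sub (q : K) {n i l : ℕ} (h : qPoch q q n ≠ 0) (hi : i ≤ n)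
    (hl : l ≤ n) : gaussBinom q n i * gaussBinom q (n - i) l =
      gaussBinom q n l * gaussBinom q (n - l) i := by
  rcases le_or_gt (i + l) n with hil | hil
  · obtain ⟨d, rfl⟩ := Nat.exists_eq_add_of_le hil
    rw [show i + l + d - i = l + d by omega, show i + l + d - l = i + d by omega]
    exact gaussBinom_mul_gaussBinom q h
  · rw [gaussBinom_eq_zero q (show n - i < l by omega),
      gaussBinom_eq_zero q (show n - l < i by omega)]
    simp

theorem gaussBinom_mul_gaussBinom_sub_sub (q : K) {n r p : ℕ} (h : qPoch q q n ≠ 0) (hr : r ≤ p)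
    (hp : p ≤ n) : gaussBinom q n r * gaussBinom q (n - r) (p - r) =
      gaussBinom q n p * gaussBinom q p r := by
  obtain ⟨l, rfl⟩ := Nat.exists_eq_add_of_le hr
  obtain ⟨d, rfl⟩ := Nat.exists_eq_add_of_le hp
  have e := gaussBinom_mul_gaussBinom q (i := r) (l := d) (d := l) (by
    rwa [show r + d + l = r + l + d by ring])
  rw [show r + l + d - r = l + d by omega, show r + l - r = l by omega, gaussBinom_symm q l d,
    add_comm l d, gaussBinom_symm q (r + l) d, show r + l + d = r + d + l by ring, e]

theorem qPoch_eq_sum_of_le (x q : K) {n M : ℕ} (h : n ≤ M) : qPoch x q n =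
    ∑ l ∈ Finset.range (M + 1), (-1) ^ l * q ^ l.choose 2 * gaussBinom q n l * x ^ l := by
  rw [qPoch_eq_sum]
  refine Finset.sum_subset (Finset.range_mono (by omega)) fun l _ hl => ?_
  rw [gaussBinom_eq_zero q (by simpa using hl)]
  simp

/-- Expand the Pochhammer symbol by the `q`-binomial theorem and exchange sums; the inner sum over i
is then `sum_gaussBinom_mul_gaussBinom_sub`. -/
theorem sum_gaussBinom_mul_qPoch (x q : K) {n c R s : ℕ} (h : n + c = R + s)
    (hn : qPoch q q n ≠ 0) :
    ∑ i ∈ Finset.range (n + 1), (-1) ^ i * q ^ i.choose 2 * gaussBinom q n i *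
      qPoch x q (n - i) * gaussBinom q (n + c - i) R =
    ∑ l ∈ Finset.range (n + 1), (-1) ^ l * q ^ (l.choose 2 + (n - l) * s) * gaussBinom q n l *
      gaussBinom q (c + l) s * x ^ l := by
  have e1 : ∀ i ∈ Finset.range (n + 1), (-1) ^ i * q ^ i.choose 2 * gaussBinom q n i *
      qPoch x q (n - i) * gaussBinom q (n + c - i) R = ∑ l ∈ Finset.range (n + 1),
      (-1) ^ l * q ^ l.choose 2 * gaussBinom q n l * x ^ l * ((-1) ^ i * q ^ i.choose 2 *
        gaussBinom q (n - l) i * gaussBinom q (n + c - i) R) := by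
    intro i hi
    rw [qPoch_eq_sum_of_le x q (Nat.sub_le n i), Finset.mul_sum, Finset.sum_mul]
    refine Finset.sum_congr rfl fun l hl => ?_
    have := gaussBinom_mul_gaussBinom_sub q hn (Nat.lt_succ_iff.mp (Finset.mem_range.mp hi))
      (Nat.lt_succ_iff.mp (Finset.mem_range.mp hl))
    linear_combination (-1) ^ i * q ^ i.choose 2 * ((-1) ^ l * q ^ l.choose 2 * x ^ l) *
      gaussBinom q (n + c - i) R * this
  rw [Finset.sum_congr rfl e1, Finset.sum_comm]
  refine Finset.sum_congr rfl fun l hl => ?_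
  have hl' := Nat.lt_succ_iff.mp (Finset.mem_range.mp hl)
  rw [← Finset.mul_sum]
  have e2 := sum_gaussBinom_mul_gaussBinom_sub q (c + l) (n - l) s (by omega)
  rw [show n - l + (c + l) = n + c by omega, show n + c - s = R by omega] at e2
  have e3 : ∑ i ∈ Finset.range (n - l + 1), (-1) ^ i * q ^ i.choose 2 * gaussBinom q (n - l) i *
      gaussBinom q (n + c - i) R = ∑ i ∈ Finset.range (n + 1), (-1) ^ i * q ^ i.choose 2 *
      gaussBinom q (n - l) i * gaussBinom q (n + c - i) R := by
    refine Finset.sum_subset (Finset.range_mono (by omega)) fun i _ hi => ?_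
    rw [gaussBinom_eq_zero q (by simpa using hi)]
    simp
  rw [← e3, e2, pow_add]
  ring

/-- The sum over the smaller index, symmetric under `(n, m) ↦ (N - m, N - n)`. -/
def reflSum (a q : K) (N n m : ℕ) : K :=
  ∑ r ∈ Finset.range (N + 1), a ^ r * q ^ (r ^ 2 + r * (N - m)) * gaussBinom q n r *
    gaussBinom q m r * qPoch q q r * qPoch q q (N - r) * qPoch (a * q ^ (N - m + r + 1)) q (m - r)

theorem choose_two_add (p r : ℕ) : (p + r).choose 2 = p.choose 2 + r.choose 2 + p * r := by
  induction r with
  | zero => simp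
  | succ r ih =>
    rw [← add_assoc, Nat.choose_succ_succ' (p + r) 1, Nat.choose_succ_succ' r 1, ih]
    simp only [Nat.choose_one_right]
    ring

theorem add_two_mul_choose_two (r : ℕ) : r + 2 * r.choose 2 = r ^ 2 := by
  induction r with
  | zero => rfl
  | succ r ih => rw [Nat.choose_succ_succ' r 1, Nat.choose_one_right]; nlinarith [ih]

/-- Expanding the last Pochhammer symbol and collecting powers of `a` by p = r + l leaves an inner
sum over r that is again a `q`-difference. The resulting form makes the symmetry visible term by
term. -/
theorem reflSum_eq (a q : K) {N n m : ℕ} (hN : qPoch q q N ≠ 0) (hn : n ≤ N) (hm : m ≤ N) :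
    reflSum a q N n m = qPoch q q n * qPoch q q (N - n) * ∑ p ∈ Finset.range (N + 1),
      (-1) ^ p * a ^ p * q ^ ((p + 1).choose 2 + p * (N - m + n)) * gaussBinom q m p *
      gaussBinom q (N - p) n := by
  have hm0 := qPoch_ne_zero_of_le hN hm
  have e1 : ∀ r ∈ Finset.range (N + 1), a ^ r * q ^ (r ^ 2 + r * (N - m)) * gaussBinom q n r *
      gaussBinom q m r * qPoch q q r * qPoch q q (N - r) *
      qPoch (a * q ^ (N - m + r + 1)) q (m - r) = ∑ p ∈ Finset.range (N + 1),
      (-1) ^ p * a ^ p * q ^ ((p + 1).choose 2 + p * (N - m)) * gaussBinom q m p *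
      (qPoch q q n * qPoch q q (N - n)) * ((-1) ^ r * q ^ r.choose 2 * gaussBinom q p r *
        gaussBinom q (N - r) (N - n)) := by
    intro r hr
    have hr' := Nat.lt_succ_iff.mp (Finset.mem_range.mp hr)
    rcases lt_or_ge n r with hnr | hnr
    · rw [gaussBinom_eq_zero q hnr, gaussBinom_eq_zero q (show N - r < N - n by omega)]
      simp
    rcases lt_or_ge m r with hmr | hmr
    · rw [gaussBinom_eq_zero q hmr]
      simp only [mul_zero, zero_mul]
      refine (Finset.sum_eq_zero fun p _ => ?_).symm
      rcases lt_or_ge p r with hpr | hpr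
      · rw [gaussBinom_eq_zero q hpr]; simp
      · rw [gaussBinom_eq_zero q (show m < p by omega)]; simp
    have e2 : gaussBinom q n r * qPoch q q r * qPoch q q (N - r) =
        qPoch q q n * qPoch q q (N - n) * gaussBinom q (N - r) (N - n) := by
      obtain ⟨d, rfl⟩ := Nat.exists_eq_add_of_le hnr
      obtain ⟨e, rfl⟩ := Nat.exists_eq_add_of_le hn
      rw [show r + d + e - r = e + d by omega, show r + d + e - (r + d) = e by omega,
        ← gaussBinom_mul_qPoch q r d, ← gaussBinom_mul_qPoch q e d]
      ring
    rw [qPoch_eq_sum (a * q ^ (N - m + r + 1))]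
    -- Only r ≤ p ≤ m contributes, so p = r + l with l ≤ m - r.
    have e3 : ∑ p ∈ Finset.range (N + 1),
      (-1) ^ p * a ^ p * q ^ ((p + 1).choose 2 + p * (N - m)) * gaussBinom q m p *
      (qPoch q q n * qPoch q q (N - n)) * ((-1) ^ r * q ^ r.choose 2 * gaussBinom q p r *
        gaussBinom q (N - r) (N - n)) = ∑ l ∈ Finset.range (m - r + 1),
      (-1) ^ (r + l) * a ^ (r + l) * q ^ ((r + l + 1).choose 2 + (r + l) * (N - m)) *
      gaussBinom q m (r + l) *
      (qPoch q q n * qPoch q q (N - n)) * ((-1) ^ r * q ^ r.choose 2 * gaussBinom q (r + l) r *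
        gaussBinom q (N - r) (N - n)) := by
      have h1 : Finset.Ico r (m + 1) ⊆ Finset.range (N + 1) := by
        intro p hp
        simp only [Finset.mem_Ico, Finset.mem_range] at *
        omega
      refine (Finset.sum_subset h1 fun p _ hp => ?_).symm.trans ?_
      · simp only [Finset.mem_Ico, not_and_or, not_le, not_lt] at hp
        rcases hp with hp | hp
        · rw [gaussBinom_eq_zero q hp]; simp
        · rw [gaussBinom_eq_zero q (show m < p by omega)]; simp
      · rw [Finset.sum_Ico_eq_sum_range, show m + 1 - r = m - r + 1 by omega]
    rw [e3, Finset.mul_sum]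
    refine Finset.sum_congr rfl fun l hl => ?_
    have hl' := Nat.lt_succ_iff.mp (Finset.mem_range.mp hl)
    have e4 := gaussBinom_mul_gaussBinom_sub_sub q hm0 (show r ≤ r + l by omega)
      (show r + l ≤ m by omega)
    rw [show r + l - r = l by omega] at e4
    have e5 : q ^ ((r + l + 1).choose 2 + (r + l) * (N - m)) * q ^ r.choose 2 =
        q ^ (r ^ 2 + r * (N - m)) * q ^ l.choose 2 * (q ^ (N - m + r + 1)) ^ l := by
      rw [← pow_add, ← pow_mul, ← pow_add, ← pow_add]
      congr 1
      rw [Nat.choose_succ_succ' (r + l) 1, choose_two_add, Nat.choose_one_right]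
      linear_combination add_two_mul_choose_two r
    have e6 : ((-1 : K) ^ r) * (-1) ^ r = 1 := by rw [← mul_pow]; simp
    calc _ = (gaussBinom q n r * qPoch q q r * qPoch q q (N - r)) *
          (gaussBinom q m r * gaussBinom q (m - r) l) * (q ^ (r ^ 2 + r * (N - m)) *
          q ^ l.choose 2 * (q ^ (N - m + r + 1)) ^ l) * a ^ r * a ^ l * (-1) ^ l := by
            rw [mul_pow]; ring
      _ = _ := by
        rw [e2, e4, ← e5, pow_add (-1 : K), pow_add a]
        linear_combination (- (qPoch q q n * qPoch q q (N - n) * gaussBinom q (N - r) (N - n)) *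
          (gaussBinom q m (r + l) * gaussBinom q (r + l) r) *
          (q ^ ((r + l + 1).choose 2 + (r + l) * (N - m)) * q ^ r.choose 2) * a ^ r * a ^ l *
          (-1) ^ l) * e6
  rw [reflSum, Finset.sum_congr rfl e1, Finset.sum_comm, Finset.mul_sum]
  refine Finset.sum_congr rfl fun p hp => ?_
  have hp' := Nat.lt_succ_iff.mp (Finset.mem_range.mp hp)
  rw [← Finset.mul_sum]
  have e2 := sum_gaussBinom_mul_gaussBinom_sub q (N - p) p n (by omega)
  rw [show p + (N - p) = N by omega] at e2
  have e3 : ∑ i ∈ Finset.range (p + 1), (-1) ^ i * q ^ i.choose 2 * gaussBinom q p i *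
      gaussBinom q (N - i) (N - n) = ∑ i ∈ Finset.range (N + 1), (-1) ^ i * q ^ i.choose 2 *
      gaussBinom q p i * gaussBinom q (N - i) (N - n) := by
    refine Finset.sum_subset (Finset.range_mono (by omega)) fun i _ hi => ?_
    rw [gaussBinom_eq_zero q (by simpa using hi)]
    simp
  rw [← e3, e2]
  rw [show q ^ ((p + 1).choose 2 + p * (N - m + n)) =
    q ^ ((p + 1).choose 2 + p * (N - m)) * q ^ (p * n) by rw [← pow_add]; congr 1; ring]
  ring

theorem reflSum_symm (a q : K) {N n m : ℕ} (hN : qPoch q q N ≠ 0) (hn : n ≤ N) (hm : m ≤ N) :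
    reflSum a q N n m = reflSum a q N (N - m) (N - n) := by
  rw [reflSum_eq a q hN hn hm, reflSum_eq a q hN (Nat.sub_le _ _) (Nat.sub_le _ _),
    Finset.mul_sum, Finset.mul_sum]
  refine Finset.sum_congr rfl fun p hp => ?_
  have hp' := Nat.lt_succ_iff.mp (Finset.mem_range.mp hp)
  rw [show N - (N - n) + (N - m) = N - m + n by omega, show N - (N - m) = m by omega]
  -- The exponent N - m + n is invariant under the reflection, so only a factorial identity for each
  -- p is left.
  suffices h : qPoch q q n * qPoch q q (N - n) * (gaussBinom q m p * gaussBinom q (N - p) n) =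
      qPoch q q (N - m) * qPoch q q m * (gaussBinom q (N - n) p *
        gaussBinom q (N - p) (N - m)) by
    linear_combination (-1) ^ p * a ^ p * q ^ ((p + 1).choose 2 + p * (N - m + n)) * h
  rcases lt_or_ge m p with h1 | h1
  · rw [gaussBinom_eq_zero q h1, gaussBinom_eq_zero q (show N - p < N - m by omega)]
    simp
  rcases lt_or_ge (N - n) p with h2 | h2
  · rw [gaussBinom_eq_zero q h2, gaussBinom_eq_zero q (show N - p < n by omega)]
    simp
  have f1 := gaussBinom_mul_qPoch q p (m - p)
  have f2 := gaussBinom_mul_qPoch q n (N - p - n)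
  have f3 := gaussBinom_mul_qPoch q p (N - n - p)
  have f4 := gaussBinom_mul_qPoch q (N - m) (m - p)
  rw [show p + (m - p) = m by omega] at f1
  rw [show n + (N - p - n) = N - p by omega] at f2
  rw [show p + (N - n - p) = N - n by omega, show N - n - p = N - p - n by omega] at f3
  rw [show N - m + (m - p) = N - p by omega] at f4
  have g : ∀ j, j ≤ N → qPoch q q j ≠ 0 := fun j hj => qPoch_ne_zero_of_le hN hj
  have h0 : qPoch q q p * qPoch q q (m - p) * qPoch q q (N - p - n) ≠ 0 :=
    mul_ne_zero (mul_ne_zero (g _ hp') (g _ (by omega))) (g _ (by omega))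
  rw [← mul_left_inj' h0]
  calc _ = qPoch q q (N - n) * (gaussBinom q m p * (qPoch q q p * qPoch q q (m - p))) *
        (gaussBinom q (N - p) n * (qPoch q q n * qPoch q q (N - p - n))) := by ring
    _ = (gaussBinom q (N - n) p * (qPoch q q p * qPoch q q (N - p - n))) * qPoch q q m *
        (gaussBinom q (N - p) (N - m) * (qPoch q q (N - m) * qPoch q q (m - p))) := by
      rw [f1, f2, f3, f4]
    _ = _ := by ring

end Transformations

/-! ### Rank-one Bailey chain and its reflection -/

section Reflection

variable {K : Type*} [Field K]

/-- The iterates of the rank-one Bailey chain with parameter `a = t ^ 2`, started at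
`1 / ((q;q)_n (tq;q)_n)`. -/
noncomputable def baileyIter (t q : K) : ℕ → ℕ → K
  | 0, n => 1 / (qPoch q q n * qPoch (t * q) q n)
  | k + 1, n => ∑ r ∈ Finset.range (n + 1),
      t ^ (2 * r) * q ^ (r ^ 2) / qPoch q q (n - r) * baileyIter t q k r

/-- The upper triangular matrix intertwining the Bailey chains of `t` and `t⁻¹ q ^ (-N)`. -/
noncomputable def reflKernel (t q : K) (N n m : ℕ) : K :=
  if n ≤ m then
    gaussBinom q (N - n) (m - n) * (qPoch q q m / qPoch q q n) /
      (t ^ (2 * m) * q ^ (N * m + (m - n) * (N - m))) *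
      qPoch (t ^ 2 * q ^ (N - (m - n) + 1)) q (m - n)
  else 0

theorem gaussBinom_div_qPoch {q : K} {n r : ℕ} (h : qPoch q q n ≠ 0) (hr : r ≤ n) :
    1 / qPoch q q (n - r) = gaussBinom q n r * qPoch q q r / qPoch q q n := by
  obtain ⟨d, rfl⟩ := Nat.exists_eq_add_of_le hr
  have e := gaussBinom_mul_qPoch q r d
  rw [Nat.add_sub_cancel_left]
  have hd : qPoch q q d ≠ 0 := qPoch_ne_zero_of_le h (by omega)
  rw [div_eq_div_iff hd h, ← e]
  ring

/-- No summation is performed: the two sums agree term by term once 1/(q;q)_(n-r) is written through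
a Gaussian binomial. -/
theorem sum_mul_reflKernel {t q : K} (ht : t ≠ 0) (hq : q ≠ 0) {N n m : ℕ}
    (hN : qPoch q q N ≠ 0) (hn : n ≤ N) (hm : m ≤ N) :
    ∑ r ∈ Finset.range (n + 1), t ^ (2 * r) * q ^ (r ^ 2) / qPoch q q (n - r) *
      reflKernel t q N r m = reflSum (t ^ 2) q N n m /
        (t ^ (2 * m) * q ^ (N * m + m * (N - m)) * qPoch q q (N - m) * qPoch q q n) := by
  have g : ∀ j, j ≤ N → qPoch q q j ≠ 0 := fun j hj => qPoch_ne_zero_of_le hN hj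
  have e1 : ∑ r ∈ Finset.range (n + 1), t ^ (2 * r) * q ^ (r ^ 2) / qPoch q q (n - r) *
      reflKernel t q N r m = ∑ r ∈ Finset.range (N + 1), (if r ≤ n then
      t ^ (2 * r) * q ^ (r ^ 2) / qPoch q q (n - r) * reflKernel t q N r m else 0) := by
    rw [← Finset.sum_subset (Finset.range_mono (show n + 1 ≤ N + 1 by omega))]
    · refine Finset.sum_congr rfl fun r hr => ?_
      rw [if_pos (Nat.lt_succ_iff.mp (Finset.mem_range.mp hr))]
    · intro r _ hr
      rw [if_neg (by simpa using hr)]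
  rw [e1, reflSum, Finset.sum_div]
  refine Finset.sum_congr rfl fun r hr => ?_
  have hrN := Nat.lt_succ_iff.mp (Finset.mem_range.mp hr)
  split_ifs with hrn
  swap
  · rw [gaussBinom_eq_zero q (show n < r by omega)]; simp
  rw [reflKernel]
  split_ifs with hrm
  swap
  · rw [gaussBinom_eq_zero q (show m < r by omega)]; simp
  have f1 := gaussBinom_div_qPoch (g n hn) hrn
  rw [div_eq_mul_one_div _ (qPoch q q (n - r)), f1]
  obtain ⟨d, rfl⟩ := Nat.exists_eq_add_of_le hrm
  obtain ⟨e, rfl⟩ := Nat.exists_eq_add_of_le hm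
  have f2 := gaussBinom_mul_qPoch q d e
  have f3 := gaussBinom_mul_qPoch q r d
  rw [show r + d + e - r = d + e by omega, show r + d - r = d by omega,
    show r + d + e - (r + d) = e by omega, show r + d + e - d + 1 = e + r + 1 by omega, ← f2, ← f3]
  have h1 := g r (by omega)
  have h2 := g e (by omega)
  have h3 := g n hn
  have h4 : q ^ ((r + d + e) * (r + d) + (r + d) * e) =
    q ^ ((r + d + e) * (r + d) + d * e) * q ^ (r * e) := by rw [← pow_add]; congr 1; ring
  rw [h4, pow_add q (r ^ 2), ← pow_mul]
  field_simp

theorem sum_reflKernel_mul {t q : K} (ht : t ≠ 0) (hq : q ≠ 0) {N n m : ℕ}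
    (hN : qPoch q q N ≠ 0) (hn : n ≤ N) (hm : m ≤ N) :
    ∑ r ∈ Finset.range (N + 1), reflKernel t q N n r *
      (if m ≤ r then 1 / qPoch q q (r - m) else 0) = reflSum (t ^ 2) q N (N - m) (N - n) /
        (t ^ (2 * N) * q ^ (N ^ 2) * qPoch q q (N - m) * qPoch q q n) := by
  have g : ∀ j, j ≤ N → qPoch q q j ≠ 0 := fun j hj => qPoch_ne_zero_of_le hN hj
  -- With u = N - r the terms again match one by one.
  rw [reflSum, Finset.sum_div, ← Finset.sum_range_reflect]
  refine Finset.sum_congr rfl fun u hu => ?_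
  have huN := Nat.lt_succ_iff.mp (Finset.mem_range.mp hu)
  rw [show N + 1 - 1 - u = N - u by omega]
  split_ifs with h1
  swap
  · rw [gaussBinom_eq_zero q (show N - m < u by omega)]; simp
  rw [reflKernel]
  split_ifs with h2
  swap
  · rw [gaussBinom_eq_zero q (show N - n < u by omega)]; simp
  have f1 := gaussBinom_div_qPoch (g (N - m) (by omega)) (show u ≤ N - m by omega)
  rw [show N - u - m = N - m - u by omega, f1]
  obtain ⟨d, hd⟩ := Nat.exists_eq_add_of_le h2
  obtain rfl : N = n + d + u := by omega
  rw [show n + d + u - (n + d + u - n) = n by omega, show n + d + u - u = n + d by omega,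
    show n + d + u - n = d + u by omega, show n + d - n = d by omega, gaussBinom_symm q d u,
    show n + d + u - d + 1 = n + u + 1 by omega, show d + u - u = d by omega,
    show n + d + u - (n + d) = u by omega]
  have h3 := g (n + d + u - m) (by omega)
  have h4 := g n hn
  have h5 : q ^ ((n + d + u) ^ 2) = q ^ ((n + d + u) * (n + d) + d * u) * q ^ (u ^ 2 + u * n) := by
    rw [← pow_add]; congr 1; ring
  have h6 : t ^ (2 * (n + d + u)) = t ^ (2 * (n + d)) * (t ^ 2) ^ u := by ring
  rw [h5, h6]
  field_simp

theorem reflKernel_intertwine {t q : K} (ht : t ≠ 0) (hq : q ≠ 0) {N n m : ℕ}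
    (hN : qPoch q q N ≠ 0) (hn : n ≤ N) (hm : m ≤ N) :
    ∑ r ∈ Finset.range (n + 1), t ^ (2 * r) * q ^ (r ^ 2) / qPoch q q (n - r) *
      reflKernel t q N r m = t ^ (2 * N) * q ^ (N ^ 2) *
      ∑ r ∈ Finset.range (N + 1), reflKernel t q N n r *
      ((if m ≤ r then 1 / qPoch q q (r - m) else 0) *
        ((t⁻¹ * q ^ (-(N : ℤ))) ^ (2 * m) * q ^ (m ^ 2))) := by
  simp only [← mul_assoc]
  rw [← Finset.sum_mul, ← Finset.sum_mul, sum_mul_reflKernel ht hq hN hn hm,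
    sum_reflKernel_mul ht hq hN hn hm, reflSum_symm _ q hN hn hm]
  have h1 := qPoch_ne_zero_of_le hN (Nat.sub_le N m)
  have h2 := qPoch_ne_zero_of_le hN hn
  have h3 : q ^ (N * m + m * (N - m)) * q ^ (m ^ 2) = (q ^ N) ^ (2 * m) := by
    rw [← pow_add, ← pow_mul]
    congr 1
    obtain ⟨d, rfl⟩ := Nat.exists_eq_add_of_le hm
    rw [Nat.add_sub_cancel_left]
    ring
  rw [zpow_neg, zpow_natCast, mul_pow, inv_pow, inv_pow, ← h3]
  field_simp

/-- Reversal of a Pochhammer product: the hypothesis says y = q^(1-m)/u, so the factors pair off in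
opposite order. -/
theorem qPoch_mul_pow_of_mul_eq {u y q : K} (hq : q ≠ 0) (m : ℕ) (h : u * y * q ^ m = q) :
    qPoch u q m * (y ^ m * q ^ m.choose 2) = (-1) ^ m * qPoch y q m := by
  induction m generalizing u with
  | zero => simp [qPoch_zero]
  | succ m ih =>
    have e1 := ih (u := u * q) (by linear_combination h)
    have e2 : u * y * q ^ m = 1 := by
      exact mul_right_cancel₀ hq (by linear_combination h)
    rw [qPoch_succ_left, qPoch_succ y, Nat.choose_succ_succ' m 1, Nat.choose_one_right]
    rw [pow_succ (-1 : K), pow_succ y, pow_add q]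
    linear_combination (1 - u) * y * q ^ m * e1 - (-1) ^ m * qPoch y q m * e2

/-- The scalar by which `reflKernel` has to be multiplied to map initial values to initial
values. -/
noncomputable def reflScalar (t q : K) (N : ℕ) : K :=
  (-1) ^ N * t ^ N * q ^ (N + 1).choose 2 * (1 - t) / (1 - t * q ^ N)

theorem baileyIter_zero_reflect {t q : K} (ht : t ≠ 0) (hq : q ≠ 0) {N n : ℕ}
    (hN : qPoch q q N ≠ 0) (hT : qPoch t q (N + 1) ≠ 0) (hn : n ≤ N) :
    baileyIter t q 0 n = reflScalar t q N * ∑ m ∈ Finset.range (N + 1),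
      reflKernel t q N n m * baileyIter (t⁻¹ * q ^ (-(N : ℤ))) q 0 m := by
  have g : ∀ j, j ≤ N → qPoch q q j ≠ 0 := fun j hj => qPoch_ne_zero_of_le hN hj
  obtain ⟨S, rfl⟩ := Nat.exists_eq_add_of_le hn
  have hT1 : qPoch t q (n + S) ≠ 0 := qPoch_ne_zero_of_le hT (by omega)
  have hT2 : 1 - t * q ^ (n + S) ≠ 0 := by
    rw [qPoch_succ] at hT; exact right_ne_zero_of_mul hT
  have hT4 : (1 - t) * qPoch (t * q) q (n + S) = qPoch t q (n + S) * (1 - t * q ^ (n + S)) := by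
    rw [← qPoch_succ_left, qPoch_succ]
  have hT3 : 1 - t ≠ 0 := fun h0 => hT (by rw [qPoch_succ_left, h0, zero_mul])
  have hT5 : qPoch (t * q) q (n + S) ≠ 0 := fun h0 => hT (by rw [qPoch_succ_left, h0, mul_zero])
  have hT6 : qPoch (t * q) q n * qPoch (t * q ^ (n + 1)) q S = qPoch (t * q) q (n + S) := by
    rw [qPoch_add]; congr 2; ring
  have hT7 : qPoch (t * q) q n ≠ 0 := qPoch_ne_zero_of_le hT5 (by omega)
  have key : ∀ e ∈ Finset.range (S + 1), reflKernel t q (n + S) n (n + S - e) *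
      baileyIter (t⁻¹ * q ^ (-((n + S : ℕ) : ℤ))) q 0 (n + S - e) * reflScalar t q (n + S) =
      (-1) ^ e * (t * q ^ (n + 1)) ^ e * q ^ e.choose 2 * gaussBinom q S e * qPoch t q e *
      qPoch (t * (t * q ^ (n + 1)) * q ^ e) q (S - e) /
        (qPoch q q n * qPoch (t * q) q (n + S)) := by
    intro e he
    have he' := Nat.lt_succ_iff.mp (Finset.mem_range.mp he)
    obtain ⟨d, rfl⟩ := Nat.exists_eq_add_of_le he'
    -- Reversal turns the denominator (t'q;q)_(n+d) into (tq^e;q)_(n+d), whose reciprocal is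
    -- (t;q)_e/(t;q)_N. This produces the factor (t;q)_e of the summation formula with x = t, y =
    -- tq^(n+1).
    have f0 : t⁻¹ * q ^ (-((n + (e + d) : ℕ) : ℤ)) * q * (t * q ^ e) * q ^ (n + d) = q := by
      rw [zpow_neg, zpow_natCast, show n + (e + d) = e + (n + d) by ring, pow_add]
      field_simp
    have f1 := qPoch_mul_pow_of_mul_eq hq (n + d) f0
    have f2 : qPoch t q e * qPoch (t * q ^ e) q (n + d) = qPoch t q (n + (e + d)) := by
      rw [← qPoch_add]; congr 1; ring
    have f3 : qPoch (t * q ^ e) q (n + d) ≠ 0 := fun h0 => hT1 (by rw [← f2, h0, mul_zero])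
    have f4 : qPoch t q e ≠ 0 := fun h0 => hT1 (by rw [← f2, h0, zero_mul])
    have f5 : qPoch (t⁻¹ * q ^ (-((n + (e + d) : ℕ) : ℤ)) * q) q (n + d) ≠ 0 := by
      intro h0
      rw [h0, zero_mul] at f1
      exact mul_ne_zero (pow_ne_zero _ (by simp)) f3 f1.symm
    rw [show n + (e + d) - e = n + d by omega, reflKernel, if_pos (by omega), baileyIter,
      reflScalar, show n + (e + d) - n = e + d by omega, show n + d - n = d by omega,
      show e + d - e = d by omega, show n + (e + d) - d + 1 = n + e + 1 by omega,
      show n + (e + d) - (n + d) = e by omega, gaussBinom_symm q e d,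
      show t * (t * q ^ (n + 1)) * q ^ e = t ^ 2 * q ^ (n + e + 1) by ring]
    have h1 := g (n + d) (by omega)
    have h2 := g n (by omega)
    have f6 : 1 / qPoch (t⁻¹ * q ^ (-((n + (e + d) : ℕ) : ℤ)) * q) q (n + d) =
        (-1) ^ (n + d) * ((t * q ^ e) ^ (n + d) * q ^ (n + d).choose 2) * qPoch t q e /
          qPoch t q (n + (e + d)) := by
      rw [← f2]
      rw [div_eq_div_iff f5 (mul_ne_zero f4 f3)]
      have : ((-1 : K) ^ (n + d)) * (-1) ^ (n + d) = 1 := by rw [← mul_pow]; simp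
      linear_combination (-(-1) ^ (n + d) * qPoch t q e) * f1 -
        qPoch t q e * qPoch (t * q ^ e) q (n + d) * this
    have f7 : 1 / qPoch (t * q) q (n + (e + d)) =
        (1 - t) / (qPoch t q (n + (e + d)) * (1 - t * q ^ (n + (e + d)))) := by
      rw [← hT4]; field_simp
    have f8 : q ^ (n + (e + d) + 1).choose 2 * (q ^ (e * (n + d)) * q ^ (n + d).choose 2) =
        q ^ ((n + 1) * e) * q ^ e.choose 2 * q ^ ((n + (e + d)) * (n + d) + d * e) := by
      simp only [← pow_add]
      congr 1
      rw [show n + (e + d) + 1 = e + (n + d) + 1 by ring, Nat.choose_succ_succ' (e + (n + d)) 1,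
        choose_two_add, Nat.choose_one_right]
      linear_combination add_two_mul_choose_two (n + d)
    have f9 : (-1 : K) ^ (n + (e + d)) * (-1) ^ (n + d) = (-1) ^ e := by
      have : ((-1 : K) ^ (n + d)) * (-1) ^ (n + d) = 1 := by rw [← mul_pow]; simp
      rw [show n + (e + d) = e + (n + d) by ring, pow_add]
      linear_combination (-1) ^ e * this
    calc _ = gaussBinom q (e + d) d / qPoch q q n * qPoch (t ^ 2 * q ^ (n + e + 1)) q d *
          (1 / qPoch (t⁻¹ * q ^ (-((n + (e + d) : ℕ) : ℤ)) * q) q (n + d)) *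
          ((-1) ^ (n + (e + d)) * t ^ (n + (e + d)) * q ^ (n + (e + d) + 1).choose 2 * (1 - t) /
            (1 - t * q ^ (n + (e + d)))) / (t ^ (2 * (n + d)) *
            q ^ ((n + (e + d)) * (n + d) + d * e)) := by
          field_simp
      _ = gaussBinom q (e + d) d / qPoch q q n * qPoch (t ^ 2 * q ^ (n + e + 1)) q d *
          ((-1) ^ (n + (e + d)) * (-1) ^ (n + d)) * (q ^ (n + (e + d) + 1).choose 2 *
            (q ^ (e * (n + d)) * q ^ (n + d).choose 2)) * qPoch t q e * t ^ e *
          ((1 - t) / (qPoch t q (n + (e + d)) * (1 - t * q ^ (n + (e + d))))) /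
            q ^ ((n + (e + d)) * (n + d) + d * e) := by
          rw [f6, mul_pow, show n + (e + d) = e + (n + d) by ring, pow_add t e,
            show 2 * (n + d) = (n + d) + (n + d) by ring, pow_add t (n + d) (n + d), ← pow_mul]
          rw [show n + (e + d) = e + (n + d) by ring] at hT1 hT2
          field_simp
      _ = _ := by
          rw [f8, f9, ← f7, mul_pow, ← pow_mul]
          field_simp
  have e1 : ∑ m ∈ Finset.range (n + S + 1), reflKernel t q (n + S) n m *
      baileyIter (t⁻¹ * q ^ (-((n + S : ℕ) : ℤ))) q 0 m = ∑ e ∈ Finset.range (S + 1),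
      reflKernel t q (n + S) n (n + S - e) *
      baileyIter (t⁻¹ * q ^ (-((n + S : ℕ) : ℤ))) q 0 (n + S - e) := by
    -- Put e = N - m; the terms with e > S lie below the diagonal of `reflKernel`.
    rw [← Finset.sum_range_reflect, eq_comm]
    refine (Finset.sum_subset (Finset.range_mono (show S + 1 ≤ n + S + 1 by omega)) ?_).trans ?_
    · intro e he1 he
      have : ¬ e < S + 1 := by simpa using he
      have := Finset.mem_range.mp he1
      rw [reflKernel]
      by_cases hh : n ≤ n + S - e
      · omega
      · rw [if_neg hh, zero_mul]
    · rfl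
  rw [e1, mul_comm, Finset.sum_mul, Finset.sum_congr rfl key, ← Finset.sum_div,
    sum_qPoch_mul_qPoch_mul_pow, baileyIter, ← hT6]
  have h2 := g n (by omega)
  have h3 : qPoch (t * q ^ (n + 1)) q S ≠ 0 := fun h0 => hT5 (by rw [← hT6, h0, mul_zero])
  field_simp

theorem baileyIter_reflect {t q : K} (ht : t ≠ 0) (hq : q ≠ 0) {N n : ℕ}
    (hN : qPoch q q N ≠ 0) (hT : qPoch t q (N + 1) ≠ 0) (hn : n ≤ N) (k : ℕ) :
    baileyIter t q k n = (t ^ (2 * N) * q ^ (N ^ 2)) ^ k * (reflScalar t q N *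
      ∑ m ∈ Finset.range (N + 1),
      reflKernel t q N n m * baileyIter (t⁻¹ * q ^ (-(N : ℤ))) q k m) := by
  induction k generalizing n with
  | zero => rw [pow_zero, one_mul]; exact baileyIter_zero_reflect ht hq hN hT hn
  | succ k ih =>
    have e1 : baileyIter t q (k + 1) n = ∑ r ∈ Finset.range (n + 1), ∑ m ∈ Finset.range (N + 1),
        (t ^ (2 * N) * q ^ (N ^ 2)) ^ k * reflScalar t q N *
        baileyIter (t⁻¹ * q ^ (-(N : ℤ))) q k m *
        (t ^ (2 * r) * q ^ (r ^ 2) / qPoch q q (n - r) * reflKernel t q N r m) := by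
      rw [baileyIter]
      refine Finset.sum_congr rfl fun r hr => ?_
      rw [ih ((Nat.lt_succ_iff.mp (Finset.mem_range.mp hr)).trans hn), Finset.mul_sum,
        Finset.mul_sum, Finset.mul_sum]
      exact Finset.sum_congr rfl fun m _ => by ring
    have e2 : ∀ r ∈ Finset.range (N + 1), baileyIter (t⁻¹ * q ^ (-(N : ℤ))) q (k + 1) r =
        ∑ m ∈ Finset.range (N + 1), ((if m ≤ r then 1 / qPoch q q (r - m) else 0) *
        ((t⁻¹ * q ^ (-(N : ℤ))) ^ (2 * m) * q ^ (m ^ 2))) *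
        baileyIter (t⁻¹ * q ^ (-(N : ℤ))) q k m := by
      intro r hr
      have hr' := Finset.mem_range.mp hr
      rw [baileyIter, ← Finset.sum_subset (Finset.range_mono (show r + 1 ≤ N + 1 by omega))]
      · refine Finset.sum_congr rfl fun m hm => ?_
        rw [if_pos (Nat.lt_succ_iff.mp (Finset.mem_range.mp hm))]
        ring
      · intro m _ hm
        rw [if_neg (by simpa using hm)]
        simp
    have e3 : ∑ r ∈ Finset.range (N + 1), reflKernel t q N n r *
        baileyIter (t⁻¹ * q ^ (-(N : ℤ))) q (k + 1) r = ∑ m ∈ Finset.range (N + 1),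
        ∑ r ∈ Finset.range (N + 1), reflKernel t q N n r *
        (((if m ≤ r then 1 / qPoch q q (r - m) else 0) *
        ((t⁻¹ * q ^ (-(N : ℤ))) ^ (2 * m) * q ^ (m ^ 2))) *
        baileyIter (t⁻¹ * q ^ (-(N : ℤ))) q k m) := by
      rw [Finset.sum_comm]
      refine Finset.sum_congr rfl fun r hr => ?_
      rw [e2 r hr, Finset.mul_sum]
    rw [e1, Finset.sum_comm, e3, Finset.mul_sum, Finset.mul_sum]
    refine Finset.sum_congr rfl fun m hm => ?_
    rw [← Finset.mul_sum, reflKernel_intertwine ht hq hN hn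
      (Nat.lt_succ_iff.mp (Finset.mem_range.mp hm)), Finset.mul_sum, Finset.mul_sum,
      Finset.mul_sum, Finset.mul_sum]
    exact Finset.sum_congr rfl fun r _ => by ring

theorem baileyIter_reflect_self {t q : K} (ht : t ≠ 0) (hq : q ≠ 0) {N : ℕ}
    (hN : qPoch q q N ≠ 0) (hT : qPoch t q (N + 1) ≠ 0) (k : ℕ) :
    baileyIter t q (k + 1) N / qPoch (t * q) q N =
      (1 - t) ^ 2 * q ^ N * (t ^ (2 * N) * q ^ (N ^ 2)) ^ k / (1 - t * q ^ N) ^ 2 *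
      (baileyIter (t⁻¹ * q ^ (-(N : ℤ))) q (k + 1) N /
        qPoch (t⁻¹ * q ^ (-(N : ℤ)) * q) q N) := by
  have e0 : ∀ m ∈ Finset.range N, reflKernel t q N N m *
      baileyIter (t⁻¹ * q ^ (-(N : ℤ))) q (k + 1) m = 0 := by
    intro m hm
    rw [reflKernel, if_neg (not_le.mpr (Finset.mem_range.mp hm)), zero_mul]
  -- The diagonal entry cancels one of the k + 1 factors gained from the intertwining relation.
  have e1 : reflKernel t q N N N = (t ^ (2 * N) * q ^ (N ^ 2))⁻¹ := by
    rw [reflKernel, if_pos le_rfl, div_self hN, Nat.sub_self, qPoch_zero, sq]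
    simp
  have f0 : t⁻¹ * q ^ (-(N : ℤ)) * q * t * q ^ N = q := by
    rw [zpow_neg, zpow_natCast]
    field_simp
  have f1 := qPoch_mul_pow_of_mul_eq hq N f0
  have hT1 : qPoch t q N ≠ 0 := qPoch_ne_zero_of_le hT (by omega)
  have hT2 : 1 - t * q ^ N ≠ 0 := by
    rw [qPoch_succ] at hT; exact right_ne_zero_of_mul hT
  have hT4 : (1 - t) * qPoch (t * q) q N = qPoch t q N * (1 - t * q ^ N) := by
    rw [← qPoch_succ_left, qPoch_succ]
  have hT3 : 1 - t ≠ 0 := fun h0 => hT (by rw [qPoch_succ_left, h0, zero_mul])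
  have hT5 : qPoch (t * q) q N ≠ 0 := fun h0 => hT (by rw [qPoch_succ_left, h0, mul_zero])
  have f5 : qPoch (t⁻¹ * q ^ (-(N : ℤ)) * q) q N ≠ 0 := by
    intro h0
    rw [h0, zero_mul] at f1
    exact mul_ne_zero (pow_ne_zero _ (by simp)) hT1 f1.symm
  rw [baileyIter_reflect ht hq hN hT le_rfl, Finset.sum_range_succ, Finset.sum_eq_zero e0,
    zero_add, e1, pow_succ, reflScalar, Nat.choose_succ_succ' N 1, Nat.choose_one_right,
    pow_add q N]
  generalize baileyIter (t⁻¹ * q ^ (-(N : ℤ))) q (k + 1) N = B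
  generalize qPoch (t⁻¹ * q ^ (-(N : ℤ)) * q) q N = X at *
  have : ((-1 : K) ^ N) * (-1) ^ N = 1 := by rw [← mul_pow]; simp
  have f6 : (-1) ^ N * t ^ N * q ^ N.choose 2 * X * (1 - t * q ^ N) =
      (1 - t) * qPoch (t * q) q N := by
    rw [hT4]
    linear_combination (-1) ^ N * (1 - t * q ^ N) * f1 + qPoch t q N * (1 - t * q ^ N) * this
  have h9 : t ^ (2 * N) * q ^ (N ^ 2) ≠ 0 := mul_ne_zero (pow_ne_zero _ ht) (pow_ne_zero _ hq)
  generalize t ^ (2 * N) * q ^ (N ^ 2) = c at *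
  rw [div_mul_div_comm, div_eq_div_iff hT5 (mul_ne_zero (pow_ne_zero 2 hT2) f5)]
  field_simp
  linear_combination B * f6

end Reflection

/-! ### From the rank-one chain to the rank-two chain -/

section Kernel

variable {K : Type*} [Field K]

/-- The monomial `t ^ (2r - s) q ^ (r² - rs + s²)`. -/
def chainWeight (t q : K) (r s : ℕ) : K :=
  t ^ (2 * (r : ℤ) - s) * q ^ ((r : ℤ) ^ 2 - r * s + (s : ℤ) ^ 2)

/-- The partial sums of the rank-two chain, with prescribed last entries `r` and `s`. -/
noncomputable def chainVec (t q : K) : ℕ → ℕ → ℕ → K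
  | 0, r, s => gaussBinom q r s / (qPoch q q s * qPoch (t * q) q r ^ 2)
  | k + 1, r, s => if s ≤ r then ∑ r' ∈ Finset.range (r + 1), ∑ s' ∈ Finset.range (s + 1),
      gaussBinom q (r - s') (r - s) / qPoch q q (r - r') * chainWeight t q r' s' *
        chainVec t q k r' s' else 0

/-- The matrix intertwining the rank-one Bailey chain with the rank-two chain. -/
noncomputable def chainKernel (t q : K) (r s n : ℕ) : K :=
  if n ≤ r then (-1) ^ (n - s) * q ^ (r - n).choose 2 * qPoch t q (n - s) * gaussBinom q n s /
    (t ^ (r - s) * q ^ (r - s).choose 2 * qPoch q q (r - n) * qPoch (t * q) q r) else 0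

theorem chainKernel_eq_zero (t q : K) {r s n : ℕ} (h : n < s) : chainKernel t q r s n = 0 := by
  rw [chainKernel, gaussBinom_eq_zero q h]
  simp

/-- `chainKernel` is supported on s ≤ n ≤ r; such sums are re-indexed from the top by i = r - n. -/
theorem sum_eq_sum_sub {M : Type*} [AddCommMonoid M] (f : ℕ → M) {d r N : ℕ} (hd : d ≤ r)
    (hr : r ≤ N) (h1 : ∀ n, n < r - d → f n = 0) (h2 : ∀ n, r < n → f n = 0) :
    ∑ n ∈ Finset.range (N + 1), f n = ∑ i ∈ Finset.range (d + 1), f (r - i) := by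
  rw [← Finset.sum_subset (Finset.range_mono (show r + 1 ≤ N + 1 by omega)),
    ← Finset.sum_range_reflect,
    ← Finset.sum_subset (Finset.range_mono (show d + 1 ≤ r + 1 by omega))]
  · rfl
  · intro i hi hi'
    simp only [Finset.mem_range] at hi hi'
    exact h1 _ (by omega)
  · intro n _ hn
    simp only [Finset.mem_range] at hn
    exact h2 _ (by omega)

/-- With n = r - i this is `sum_qPoch_mul_qPoch` at x = t, y = tq^(s+1), where the product on the
right becomes t^R (q^(s+1);q)_R. -/
theorem chainVec_zero {t q : K} (ht : t ≠ 0) (hq : q ≠ 0) {N r s : ℕ} (hN : qPoch q q N ≠ 0)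
    (hT : qPoch (t * q) q N ≠ 0) (hr : r ≤ N) : chainVec t q 0 r s =
      ∑ n ∈ Finset.range (N + 1), chainKernel t q r s n * baileyIter t q 0 n := by
  rcases lt_or_ge r s with hs | hs
  · rw [chainVec, gaussBinom_eq_zero q hs, Finset.sum_eq_zero]
    · simp
    · intro n _
      rcases lt_or_ge n s with hn | hn
      · rw [chainKernel_eq_zero t q hn, zero_mul]
      · rw [chainKernel, if_neg (by omega), zero_mul]
  obtain ⟨R, rfl⟩ := Nat.exists_eq_add_of_le hs
  have g : ∀ j, j ≤ N → qPoch q q j ≠ 0 := fun j hj => qPoch_ne_zero_of_le hN hj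
  have gT : ∀ j, j ≤ N → qPoch (t * q) q j ≠ 0 := fun j hj => qPoch_ne_zero_of_le hT hj
  rw [sum_eq_sum_sub _ (show R ≤ s + R by omega) hr]
  rotate_left
  · intro n hn
    rw [chainKernel_eq_zero t q (by omega), zero_mul]
  · intro n hn
    rw [chainKernel, if_neg (by omega), zero_mul]
  have key : ∀ i ∈ Finset.range (R + 1), chainKernel t q (s + R) s (s + R - i) *
      baileyIter t q 0 (s + R - i) = ((-1) ^ i * q ^ i.choose 2 * gaussBinom q R i *
      qPoch t q (R - i) * qPoch (t * q ^ (s + 1) * q ^ (R - i)) q i) * ((-1) ^ R /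
      (t ^ R * q ^ R.choose 2 * qPoch (t * q) q (s + R) ^ 2 * qPoch q q s * qPoch q q R)) := by
    intro i hi
    have hi' := Nat.lt_succ_iff.mp (Finset.mem_range.mp hi)
    obtain ⟨d, rfl⟩ := Nat.exists_eq_add_of_le hi'
    rw [chainKernel, if_pos (Nat.sub_le _ _), baileyIter, show s + (i + d) - i = s + d by omega,
      show s + d - s = d by omega, show s + (i + d) - (s + d) = i by omega,
      show s + (i + d) - s = i + d by omega, show i + d - i = d by omega]
    have f1 := gaussBinom_mul_qPoch q s d
    have f2 := gaussBinom_mul_qPoch q i d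
    have f3 : qPoch (t * q) q (s + (i + d)) = qPoch (t * q) q (s + d) *
        qPoch (t * q ^ (s + 1) * q ^ d) q i := by
      rw [show s + (i + d) = s + d + i by ring, qPoch_add]; congr 2; ring
    have f4 : ((-1 : K) ^ i) * (-1) ^ (i + d) = (-1) ^ d := by
      rw [pow_add, ← mul_assoc, ← mul_pow]; simp
    have h1 := gT _ hr
    have h2 : qPoch (t * q) q (s + d) ≠ 0 := gT _ (by omega)
    have h3 : qPoch (t * q ^ (s + 1) * q ^ d) q i ≠ 0 := fun h0 => h1 (by rw [f3, h0, mul_zero])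
    have h4 := g (s + d) (by omega)
    have h5 := g (i + d) (by omega)
    have h6 := g i (by omega)
    have h7 := g d (by omega)
    have h8 := g s (by omega)
    rw [f3, ← f1, ← f2, ← f4]
    rw [← f1] at h4
    rw [← f2] at h5
    have h9 := left_ne_zero_of_mul h4
    have h10 := left_ne_zero_of_mul h5
    field_simp
  rw [Finset.sum_congr rfl key, ← Finset.sum_mul, sum_qPoch_mul_qPoch, chainVec]
  have e1 : ∏ i ∈ Finset.range R, (t - t * q ^ (s + 1) * q ^ i) =
      t ^ R * qPoch (q * q ^ s) q R := by
    have : ∀ i ∈ Finset.range R, t - t * q ^ (s + 1) * q ^ i = t * (1 - q * q ^ s * q ^ i) :=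
      fun i _ => by ring
    rw [Finset.prod_congr rfl this, Finset.prod_mul_distrib, qPoch]
    simp
  rw [e1]
  have f1 := gaussBinom_mul_qPoch q s R
  have f2 := qPoch_add q q s R
  have f4 : ((-1 : K) ^ R) * (-1) ^ R = 1 := by rw [← mul_pow]; simp
  have h1 := gT _ hr
  have h2 := g R (by omega)
  have h3 := g s (by omega)
  have f5 : qPoch (q * q ^ s) q R = gaussBinom q (s + R) s * qPoch q q R := by
    refine mul_left_cancel₀ h3 ?_
    rw [← f2, ← f1]
    ring
  rw [f5]
  calc _ = ((-1 : K) ^ R) * (-1) ^ R * (gaussBinom q (s + R) s /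
        (qPoch q q s * qPoch (t * q) q (s + R) ^ 2)) := by rw [f4, one_mul]
    _ = _ := by field_simp

/-- Reversing the sum by v = n - l and writing binomials as factorials gives an expression symmetric
in n and R. -/
theorem chainKernel_symm_aux (t q : K) {r n R : ℕ} (hr : qPoch q q r ≠ 0) (hn : n ≤ r)
    (hR : R ≤ r) :
    (-1) ^ n * t ^ R * q ^ R.choose 2 * (qPoch q q (r - R) * qPoch q q R) *
      ∑ l ∈ Finset.range (n + 1), (-1) ^ l * q ^ (l.choose 2 + (n - l) * (r - R)) *
        gaussBinom q n l * gaussBinom q (r - n + l) (r - R) * t ^ l =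
    ∑ v ∈ Finset.range (r + 1), if v ≤ n ∧ v ≤ R then (-1) ^ v * t ^ (n + R - v) *
      q ^ ((n - v).choose 2 + (R - v).choose 2 + v.choose 2 + v * (r - v)) *
      (qPoch q q n * qPoch q q R * qPoch q q (r - v)) /
      (qPoch q q v * (qPoch q q (n - v) * qPoch q q (R - v))) else 0 := by
  have g : ∀ j, j ≤ r → qPoch q q j ≠ 0 := fun j hj => qPoch_ne_zero_of_le hr hj
  rw [← Finset.sum_range_reflect, Finset.mul_sum]
  refine Eq.trans ?_ (Finset.sum_subset (Finset.range_mono (show n + 1 ≤ r + 1 by omega)) ?_)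
  swap
  · intro v _ hv
    rw [if_neg (by simp only [Finset.mem_range] at hv; omega)]
  refine Finset.sum_congr rfl fun v hv => ?_
  have hv' := Nat.lt_succ_iff.mp (Finset.mem_range.mp hv)
  rw [show n + 1 - 1 - v = n - v by omega]
  split_ifs with h
  swap
  · rw [gaussBinom_eq_zero q (show r - n + (n - v) < r - R by omega)]; simp
  obtain ⟨d, rfl⟩ := Nat.exists_eq_add_of_le h.1
  obtain ⟨e, rfl⟩ := Nat.exists_eq_add_of_le h.2
  obtain ⟨s, rfl⟩ := Nat.exists_eq_add_of_le hR
  rw [show v + d - v = d by omega, show v + e - v = e by omega,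
    show v + e + s - (v + e) = s by omega, show v + e + s - (v + d) + d = s + e by omega,
    show v + d - d = v by omega, show v + e + s - v = s + e by omega,
    show v + d + (v + e) - v = v + d + e by omega]
  have f1 := gaussBinom_mul_qPoch q d v
  have f2 := gaussBinom_mul_qPoch q s e
  have f3 : ((-1 : K) ^ (v + d)) * (-1) ^ d = (-1) ^ v := by
    rw [pow_add, mul_assoc, ← mul_pow]; simp
  have f4 : q ^ (v + e).choose 2 * q ^ (d.choose 2 + v * s) =
      q ^ (d.choose 2 + e.choose 2 + v.choose 2 + v * (s + e)) := by
    rw [← pow_add, choose_two_add]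
    congr 1
    ring
  have h1 := g v (by omega)
  have h2 := g d (by omega)
  have h3 := g e (by omega)
  rw [← f3, ← f4, ← f2, show v + d + e = (v + e) + d by ring, pow_add t (v + e) d,
    show v + d = d + v by ring, ← f1,
    eq_div_iff (mul_ne_zero h1 (mul_ne_zero h2 h3))]
  ring

theorem chainKernel_symm_sum (t q : K) {r n R : ℕ} (hr : qPoch q q r ≠ 0) (hn : n ≤ r)
    (hR : R ≤ r) :
    (-1) ^ n * t ^ R * q ^ R.choose 2 * (qPoch q q (r - R) * qPoch q q R) *
      ∑ l ∈ Finset.range (n + 1), (-1) ^ l * q ^ (l.choose 2 + (n - l) * (r - R)) *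
        gaussBinom q n l * gaussBinom q (r - n + l) (r - R) * t ^ l =
    (-1) ^ R * t ^ n * q ^ n.choose 2 * (qPoch q q (r - n) * qPoch q q n) *
      ∑ l ∈ Finset.range (R + 1), (-1) ^ l * q ^ (l.choose 2 + (R - l) * (r - n)) *
        gaussBinom q R l * gaussBinom q (r - R + l) (r - n) * t ^ l := by
  rw [chainKernel_symm_aux t q hr hn hR, chainKernel_symm_aux t q hr hR hn]
  refine Finset.sum_congr rfl fun v _ => ?_
  refine if_congr and_comm ?_ rfl
  rw [add_comm R n, add_comm ((R - v).choose 2), mul_comm (qPoch q q R),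
    mul_comm (qPoch q q (R - v))]

theorem sum_bailey_unit {t q : K} {n M : ℕ} (hq : qPoch q q (n + M) ≠ 0)
    (hT : qPoch (t * q) q (n + M) ≠ 0) :
    ∑ j ∈ Finset.range (M + 1), t ^ (n + j) * q ^ (n ^ 2 + n * j + j ^ 2) /
      (qPoch q q (M - j) * qPoch q q j * qPoch (t * q) q (n + j)) =
      t ^ n * q ^ (n ^ 2) / (qPoch q q M * qPoch (t * q) q (n + M)) := by
  have key : ∀ j ∈ Finset.range (M + 1), t ^ (n + j) * q ^ (n ^ 2 + n * j + j ^ 2) /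
      (qPoch q q (M - j) * qPoch q q j * qPoch (t * q) q (n + j)) =
      (t * q ^ n) ^ j * q ^ (j ^ 2) * gaussBinom q M j *
        qPoch (t * q ^ n * q ^ (j + 1)) q (M - j) *
        (t ^ n * q ^ (n ^ 2) / (qPoch q q M * qPoch (t * q) q (n + M))) := by
    intro j hj
    obtain ⟨d, rfl⟩ := Nat.exists_eq_add_of_le (Nat.lt_succ_iff.mp (Finset.mem_range.mp hj))
    rw [Nat.add_sub_cancel_left]
    have f1 := gaussBinom_mul_qPoch q j d
    have f2 : qPoch (t * q) q (n + (j + d)) = qPoch (t * q) q (n + j) *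
        qPoch (t * q ^ n * q ^ (j + 1)) q d := by
      rw [← add_assoc, qPoch_add]; congr 2; ring
    have h1 : qPoch q q (j + d) ≠ 0 := qPoch_ne_zero_of_le hq (by omega)
    have h2 : qPoch (t * q) q (n + j) ≠ 0 := qPoch_ne_zero_of_le hT (by omega)
    have h3 : qPoch q q j ≠ 0 := qPoch_ne_zero_of_le hq (by omega)
    have h4 : qPoch q q d ≠ 0 := qPoch_ne_zero_of_le hq (by omega)
    rw [f2] at hT ⊢
    rw [← f1] at h1 ⊢
    have h5 := left_ne_zero_of_mul h1
    have h6 := right_ne_zero_of_mul hT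
    rw [pow_add q, pow_add q, pow_add t, mul_pow, ← pow_mul]
    field_simp
  rw [Finset.sum_congr rfl key, ← Finset.sum_mul, sum_pow_sq_mul_qPoch, one_mul]

/-- Separation of variables: the cross term -rs of the quadratic form is cancelled by the binomial
exponent of r - s in the kernel's denominator, and t^(2r-s)/t^(r-s) = t^r no longer involves s. -/
theorem chainWeight_mul_chainKernel {t q : K} (ht : t ≠ 0) (hq : q ≠ 0) {s n j : ℕ}
    (hs : s ≤ n) : chainWeight t q (n + j) s * chainKernel t q (n + j) s n =
      (-1) ^ n * ((-1) ^ s * q ^ s.choose 2 * gaussBinom q n s * qPoch t q (n - s)) /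
        q ^ n.choose 2 * (t ^ (n + j) * q ^ (n ^ 2 + n * j + j ^ 2) /
          (qPoch q q j * qPoch (t * q) q (n + j))) := by
  obtain ⟨e, rfl⟩ := Nat.exists_eq_add_of_le hs
  rw [chainKernel, if_pos (by omega), show s + e - s = e by omega,
    show s + e + j - (s + e) = j by omega, show s + e + j - s = e + j by omega]
  have f1 : chainWeight t q (s + e + j) s * (t ^ s * q ^ ((s + e + j) * s)) =
      t ^ (2 * (s + e + j)) * q ^ ((s + e + j) ^ 2 + s ^ 2) := by
    rw [chainWeight]
    simp only [← zpow_natCast]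
    rw [mul_mul_mul_comm, ← zpow_add₀ ht, ← zpow_add₀ hq]
    congr 2 <;> push_cast <;> ring
  have f2 : chainWeight t q (s + e + j) s =
      t ^ (2 * (s + e + j)) * q ^ ((s + e + j) ^ 2 + s ^ 2) / (t ^ s * q ^ ((s + e + j) * s)) := by
    rw [← f1]; field_simp
  have f3 : q ^ ((s + e + j) ^ 2 + s ^ 2) * q ^ j.choose 2 * q ^ (s + e).choose 2 =
      q ^ s.choose 2 * q ^ ((s + e) ^ 2 + (s + e) * j + j ^ 2) * q ^ ((s + e + j) * s) *
        q ^ (e + j).choose 2 := by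
    simp only [← pow_add]
    congr 1
    rw [choose_two_add, choose_two_add]
    ring
  have f4 : (-1 : K) ^ e = (-1) ^ (s + e) * (-1) ^ s := by
    rw [pow_add, mul_right_comm, ← mul_pow]; simp
  rw [f2, f4]
  have f5 : t ^ (2 * (s + e + j)) = t ^ s * t ^ (e + j) * t ^ (s + e + j) := by ring
  calc _ = (q ^ ((s + e + j) ^ 2 + s ^ 2) * q ^ j.choose 2 * q ^ (s + e).choose 2) *
        (-1) ^ (s + e) * (-1) ^ s * qPoch t q e * gaussBinom q (s + e) s * t ^ (s + e + j) /
        (q ^ ((s + e + j) * s) * q ^ (e + j).choose 2 * q ^ (s + e).choose 2 *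
          (qPoch q q j * qPoch (t * q) q (s + e + j))) := by
        rw [f5]; field_simp
    _ = _ := by rw [f3]; field_simp

theorem sum_sum_chainKernel {t q : K} (ht : t ≠ 0) (hq : q ≠ 0) {N r s n : ℕ}
    (hN : qPoch q q N ≠ 0) (hT : qPoch (t * q) q N ≠ 0) (hs : s ≤ r) (hr : r ≤ N) :
    ∑ r' ∈ Finset.range (r + 1), ∑ s' ∈ Finset.range (s + 1),
      gaussBinom q (r - s') (r - s) / qPoch q q (r - r') * chainWeight t q r' s' *
        chainKernel t q r' s' n =
    ∑ m ∈ Finset.range (N + 1), chainKernel t q r s m *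
      (if n ≤ m then t ^ (2 * n) * q ^ (n ^ 2) / qPoch q q (m - n) else 0) := by
  have g : ∀ j, j ≤ N → qPoch q q j ≠ 0 := fun j hj => qPoch_ne_zero_of_le hN hj
  have gT : ∀ j, j ≤ N → qPoch (t * q) q j ≠ 0 := fun j hj => qPoch_ne_zero_of_le hT hj
  rcases lt_or_ge r n with hn | hn
  · rw [Finset.sum_eq_zero, Finset.sum_eq_zero]
    · intro m _
      split_ifs with h
      · rw [chainKernel, if_neg (by omega), zero_mul]
      · rw [mul_zero]
    · intro r' hr'
      rw [Finset.mem_range] at hr'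
      refine Finset.sum_eq_zero fun s' _ => ?_
      rw [chainKernel, if_neg (by omega), mul_zero]
  -- Cutting at s' ≤ s or at s' ≤ n gives the same sum: beyond s the binomial vanishes, beyond n the
  -- kernel does.
  have hsub : ∀ r', r' ≤ r → ∑ s' ∈ Finset.range (s + 1),
      gaussBinom q (r - s') (r - s) / qPoch q q (r - r') * chainWeight t q r' s' *
        chainKernel t q r' s' n = ∑ s' ∈ Finset.range (n + 1),
      gaussBinom q (r - s') (r - s) / qPoch q q (r - r') * chainWeight t q r' s' *
        chainKernel t q r' s' n := by
    intro r' hr'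
    rw [Finset.sum_subset (Finset.range_mono (show s + 1 ≤ r + 1 by omega)),
      Finset.sum_subset (Finset.range_mono (show n + 1 ≤ r + 1 by omega))]
    · intro s' _ h
      rw [chainKernel_eq_zero t q (by simpa using h), mul_zero]
    · intro s' h1 h
      simp only [Finset.mem_range] at h1 h
      rw [gaussBinom_eq_zero q (show r - s' < r - s by omega)]
      simp
  obtain ⟨M, rfl⟩ := Nat.exists_eq_add_of_le hn
  have e1 : ∑ r' ∈ Finset.range (n + M + 1), ∑ s' ∈ Finset.range (s + 1),
      gaussBinom q (n + M - s') (n + M - s) / qPoch q q (n + M - r') * chainWeight t q r' s' *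
        chainKernel t q r' s' n = ∑ j ∈ Finset.range (M + 1),
      ((-1) ^ n / q ^ n.choose 2 * ∑ s' ∈ Finset.range (n + 1), (-1) ^ s' * q ^ s'.choose 2 *
        gaussBinom q n s' * qPoch t q (n - s') * gaussBinom q (n + M - s') (n + M - s)) *
      (t ^ (n + j) * q ^ (n ^ 2 + n * j + j ^ 2) /
        (qPoch q q (M - j) * qPoch q q j * qPoch (t * q) q (n + j))) := by
    rw [show n + M + 1 = n + (M + 1) by ring, Finset.sum_range_add, Finset.sum_eq_zero, zero_add]
    · refine Finset.sum_congr rfl fun j hj => ?_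
      have hj' := Nat.lt_succ_iff.mp (Finset.mem_range.mp hj)
      rw [hsub _ (by omega), Finset.mul_sum, Finset.sum_mul]
      refine Finset.sum_congr rfl fun s' hs' => ?_
      rw [mul_assoc, chainWeight_mul_chainKernel ht hq
        (Nat.lt_succ_iff.mp (Finset.mem_range.mp hs')), show n + M - (n + j) = M - j by omega]
      field_simp
    · intro r' hr'
      rw [Finset.mem_range] at hr'
      refine Finset.sum_eq_zero fun s' _ => ?_
      rw [chainKernel, if_neg (by omega), mul_zero]
  rw [e1, ← Finset.mul_sum, sum_bailey_unit (g _ hr) (gT _ hr)]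
  have f1 := sum_gaussBinom_mul_qPoch t q (n := n) (c := M) (R := n + M - s) (s := s) (by omega)
    (g n (by omega))
  rw [f1]
  obtain ⟨R, hR⟩ := Nat.exists_eq_add_of_le hs
  -- The other side has the same shape as the s'-sum, with n and R = r - s exchanged.
  have e2 : ∑ m ∈ Finset.range (N + 1), chainKernel t q (n + M) s m *
      (if n ≤ m then t ^ (2 * n) * q ^ (n ^ 2) / qPoch q q (m - n) else 0) =
      ∑ i ∈ Finset.range (R + 1), ((-1) ^ i * q ^ i.choose 2 * gaussBinom q R i *
      qPoch t q (R - i) * gaussBinom q (R + s - i) n) * ((-1) ^ R * (t ^ (2 * n) * q ^ (n ^ 2)) *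
        qPoch q q n / (t ^ R * q ^ R.choose 2 * qPoch (t * q) q (n + M) * qPoch q q s *
          qPoch q q R)) := by
    rw [sum_eq_sum_sub _ (show R ≤ n + M by omega) hr]
    rotate_left
    · intro m hm
      rw [chainKernel_eq_zero t q (by omega), zero_mul]
    · intro m hm
      rw [chainKernel, if_neg (by omega), zero_mul]
    refine Finset.sum_congr rfl fun i hi => ?_
    have hi' := Nat.lt_succ_iff.mp (Finset.mem_range.mp hi)
    split_ifs with h
    swap
    · rw [gaussBinom_eq_zero q (show R + s - i < n by omega)]; simp
    rw [chainKernel, if_pos (Nat.sub_le _ _)]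
    obtain ⟨d, rfl⟩ := Nat.exists_eq_add_of_le hi'
    obtain ⟨e, he⟩ := Nat.exists_eq_add_of_le h
    rw [show n + M - i = s + d by omega] at he
    rw [show n + M - i = s + d by omega, show s + d - s = d by omega,
      show n + M - (s + d) = i by omega, show n + M - s = i + d by omega,
      show i + d - i = d by omega, show i + d + s - i = s + d by omega,
      show s + d - n = e by omega]
    have f1 := gaussBinom_mul_qPoch q s d
    have f2 := gaussBinom_mul_qPoch q i d
    have f3 := gaussBinom_mul_qPoch q n e
    rw [← he] at f3
    have f4 : (-1 : K) ^ d = (-1) ^ i * (-1) ^ (i + d) := by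
      rw [pow_add, ← mul_assoc, ← mul_pow]; simp
    have h1 := gT _ hr
    have h4 := g (s + d) (by omega)
    have h5 := g (i + d) (by omega)
    have h6 := g i (by omega)
    have h7 := g d (by omega)
    have h8 := g s (by omega)
    have h9 := g e (by omega)
    have h10 := g n (by omega)
    have f5 : gaussBinom q (s + d) s / (qPoch q q i * qPoch q q e) =
        gaussBinom q (i + d) i * gaussBinom q (s + d) n * qPoch q q n /
          (qPoch q q s * qPoch q q (i + d)) := by
      rw [div_eq_div_iff (mul_ne_zero h6 h9) (mul_ne_zero h8 h5), ← f2]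
      linear_combination gaussBinom q (i + d) i * qPoch q q i * (f1 - f3)
    calc _ = (-1) ^ d * q ^ i.choose 2 * qPoch t q d * (t ^ (2 * n) * q ^ (n ^ 2)) /
          (t ^ (i + d) * q ^ (i + d).choose 2 * qPoch (t * q) q (n + M)) *
          (gaussBinom q (s + d) s / (qPoch q q i * qPoch q q e)) := by field_simp
      _ = _ := by
        rw [f5, f4]
        field_simp
  have f2 := sum_gaussBinom_mul_qPoch t q (n := R) (c := s) (R := n) (s := M) (by omega)
    (g R (by omega))
  rw [e2, ← Finset.sum_mul, f2]
  have f3 := chainKernel_symm_sum t q (r := n + M) (n := n) (R := R) (g _ hr) (by omega) (by omega)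
  rw [show n + M - R = s by omega, show n + M - n = M by omega] at f3
  have h1 := gT _ hr
  have h2 := g R (by omega)
  have h3 := g s (by omega)
  have h4 := g M (by omega)
  have h5 : t ^ R ≠ 0 := pow_ne_zero _ ht
  generalize ∑ l ∈ Finset.range (n + 1), (-1) ^ l * q ^ (l.choose 2 + (n - l) * s) *
    gaussBinom q n l * gaussBinom q (M + l) s * t ^ l = A at *
  generalize ∑ l ∈ Finset.range (R + 1), (-1) ^ l * q ^ (l.choose 2 + (R - l) * M) *
    gaussBinom q R l * gaussBinom q (s + l) M * t ^ l = B at *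
  rw [show 2 * n = n + n by ring, pow_add]
  field_simp
  linear_combination f3

theorem chainVec_eq_sum {t q : K} (ht : t ≠ 0) (hq : q ≠ 0) {N : ℕ} (hN : qPoch q q N ≠ 0)
    (hT : qPoch (t * q) q N ≠ 0) (k : ℕ) {r s : ℕ} (hr : r ≤ N) : chainVec t q k r s =
      ∑ n ∈ Finset.range (N + 1), chainKernel t q r s n * baileyIter t q k n := by
  induction k generalizing r s with
  | zero => exact chainVec_zero ht hq hN hT hr
  | succ k ih =>
    rw [chainVec]
    split_ifs with hs
    swap
    · refine (Finset.sum_eq_zero fun n _ => ?_).symm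
      rcases lt_or_ge n s with hn | hn
      · rw [chainKernel_eq_zero t q hn, zero_mul]
      · rw [chainKernel, if_neg (by omega), zero_mul]
    have e1 : ∀ r' ∈ Finset.range (r + 1), ∑ s' ∈ Finset.range (s + 1),
        gaussBinom q (r - s') (r - s) / qPoch q q (r - r') * chainWeight t q r' s' *
        chainVec t q k r' s' = ∑ n ∈ Finset.range (N + 1), (∑ s' ∈ Finset.range (s + 1),
        gaussBinom q (r - s') (r - s) / qPoch q q (r - r') * chainWeight t q r' s' *
        chainKernel t q r' s' n) * baileyIter t q k n := by
      intro r' hr'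
      simp only [Finset.sum_mul]
      rw [Finset.sum_comm]
      refine Finset.sum_congr rfl fun s' _ => ?_
      rw [ih ((Nat.lt_succ_iff.mp (Finset.mem_range.mp hr')).trans hr), Finset.mul_sum]
      exact Finset.sum_congr rfl fun n _ => by ring
    have e2 : ∀ m ∈ Finset.range (N + 1), chainKernel t q r s m * baileyIter t q (k + 1) m =
        ∑ n ∈ Finset.range (N + 1), (chainKernel t q r s m *
        (if n ≤ m then t ^ (2 * n) * q ^ (n ^ 2) / qPoch q q (m - n) else 0)) *
        baileyIter t q k n := by
      intro m hm
      have hm' := Finset.mem_range.mp hm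
      rw [baileyIter, Finset.mul_sum,
        ← Finset.sum_subset (Finset.range_mono (show m + 1 ≤ N + 1 by omega))]
      · refine Finset.sum_congr rfl fun n hn => ?_
        rw [if_pos (Nat.lt_succ_iff.mp (Finset.mem_range.mp hn))]
        ring
      · intro n _ hn
        rw [if_neg (by simpa using hn)]
        simp
    rw [Finset.sum_congr rfl e1, Finset.sum_congr rfl e2, Finset.sum_comm,
      Finset.sum_comm (s := Finset.range (N + 1)) (t := Finset.range (N + 1))]
    refine Finset.sum_congr rfl fun n _ => ?_
    rw [← Finset.sum_mul, ← Finset.sum_mul, sum_sum_chainKernel ht hq hN hT hs hr]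

theorem chainVec_self {t q : K} (ht : t ≠ 0) (hq : q ≠ 0) {N : ℕ} (hN : qPoch q q N ≠ 0)
    (hT : qPoch (t * q) q N ≠ 0) (k : ℕ) :
    chainVec t q k N N = baileyIter t q k N / qPoch (t * q) q N := by
  rw [chainVec_eq_sum ht hq hN hT k le_rfl, Finset.sum_range_succ, Finset.sum_eq_zero, zero_add]
  · rw [chainKernel]
    simp [qPoch_zero]
    ring
  · intro n hn
    rw [chainKernel_eq_zero t q (Finset.mem_range.mp hn), zero_mul]

end Kernel

/-! ### Reduction of the multiple sum to `chainVec` -/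

section Sum

variable {K : Type*} [Field K]

/-- The function `entry` for arbitrary finite sequences. -/
def seqEntry {k : ℕ} (x : Fin k → ℕ) (i : ℕ) : ℤ :=
  if h : 1 ≤ i ∧ i ≤ k then (x ⟨i - 1, by omega⟩ : ℤ) else 0

/-- The summand `ZTerm` without its factor depending on `N`, for arbitrary finite sequences. -/
noncomputable def seqTerm (k : ℕ) (t q : K) (r s : Fin k → ℕ) : K :=
  t ^ (∑ i ∈ Finset.Icc 1 k, (2 * seqEntry r i - seqEntry s i))
    * q ^ (∑ i ∈ Finset.Icc 1 k,
        (seqEntry r i ^ 2 - seqEntry r i * seqEntry s i + seqEntry s i ^ 2))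
    * (∏ i ∈ Finset.Icc 2 k, recipPoch q (seqEntry r i - seqEntry r (i - 1)))
    * (1 / qPoch (t * q) q (seqEntry r 1).toNat ^ 2)
    * recipPoch q (seqEntry s 1)
    * ∏ i ∈ Finset.Icc 1 k,
        qBinom q (seqEntry r i - seqEntry s (i - 1)) (seqEntry r i - seqEntry s i)

theorem ZTerm_eq (k N : ℕ) (t q : K) (r s : Fin k →o ℕ) :
    ZTerm k N t q r s = recipPoch q (N - seqEntry r k) * seqTerm k t q r s := by
  simp only [ZTerm, seqTerm, seqEntry, entry]
  ring

theorem seqEntry_last {k : ℕ} (x : Fin (k + 1) → ℕ) :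
    seqEntry x (k + 1) = (x (Fin.last k) : ℤ) := by
  rw [seqEntry, dif_pos ⟨by omega, le_rfl⟩]
  rfl

theorem seqEntry_add_one {k : ℕ} (x : Fin k → ℕ) {i : ℕ} (hi : i < k) :
    seqEntry x (i + 1) = (x ⟨i, hi⟩ : ℤ) := by
  rw [seqEntry, dif_pos ⟨by omega, hi⟩]
  rfl

theorem seqEntry_snoc {k : ℕ} (x : Fin k → ℕ) (a : ℕ) {i : ℕ} (hi : i ≤ k) :
    seqEntry (Fin.snoc x a : Fin (k + 1) → ℕ) i = seqEntry x i := by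
  unfold seqEntry
  by_cases h : 1 ≤ i
  · rw [dif_pos ⟨h, by omega⟩, dif_pos ⟨h, hi⟩]
    have : (⟨i - 1, by omega⟩ : Fin (k + 1)) = Fin.castSucc ⟨i - 1, by omega⟩ := rfl
    rw [this, Fin.snoc_castSucc (α := fun _ => ℕ)]
  · rw [dif_neg (fun h' => h h'.1), dif_neg (fun h' => h h'.1)]

theorem seqEntry_snoc_last {k : ℕ} (x : Fin k → ℕ) (a : ℕ) :
    seqEntry (Fin.snoc x a : Fin (k + 1) → ℕ) (k + 1) = (a : ℤ) := by
  rw [seqEntry_last, Fin.snoc_last (α := fun _ => ℕ)]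

theorem recipPoch_sub (q : K) (a b : ℕ) :
    recipPoch q ((a : ℤ) - b) = if b ≤ a then 1 / qPoch q q (a - b) else 0 := by
  rw [recipPoch]
  refine if_congr (by omega) ?_ rfl
  rw [show ((a : ℤ) - b).toNat = a - b by omega]

theorem recipPoch_natCast (q : K) (a : ℕ) : recipPoch q (a : ℤ) = 1 / qPoch q q a := by
  simpa using recipPoch_sub q a 0

theorem qBinom_sub {q : K} {a b c : ℕ} (h : qPoch q q a ≠ 0) :
    qBinom q ((a : ℤ) - c) ((a : ℤ) - b) =
      if b ≤ a ∧ c ≤ b then gaussBinom q (a - c) (a - b) else 0 := by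
  rw [qBinom]
  split_ifs with h1 h2 h2
  · have e : a - c = (a - b) + (b - c) := by omega
    rw [e, gaussBinom_eq_div q (qPoch_ne_zero_of_le h (by omega)),
      show ((a : ℤ) - c).toNat = (a - b) + (b - c) by omega,
      show ((a : ℤ) - b).toNat = a - b by omega,
      show ((a : ℤ) - c - (a - b)).toNat = b - c by omega]
  · omega
  · omega
  · rfl

theorem seqTerm_one {t q : K} {N : ℕ} (hN : qPoch q q N ≠ 0) (r s : Fin 1 → ℕ)
    (hr : r (Fin.last 0) ≤ N) :
    seqTerm 1 t q r s = chainWeight t q (r (Fin.last 0)) (s (Fin.last 0)) *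
      chainVec t q 0 (r (Fin.last 0)) (s (Fin.last 0)) := by
  have e0 : seqEntry s 0 = ((0 : ℕ) : ℤ) := by rw [seqEntry, dif_neg (by omega)]; rfl
  have e1 : ∀ x : Fin 1 → ℕ, seqEntry x 1 = (x (Fin.last 0) : ℤ) := fun x => seqEntry_last x
  rw [seqTerm, Finset.Icc_self, Finset.sum_singleton, Finset.sum_singleton, Finset.prod_singleton,
    Finset.Icc_eq_empty (by omega), Finset.prod_empty, Nat.sub_self, e0, e1, e1,
    qBinom_sub (qPoch_ne_zero_of_le hN hr), recipPoch_natCast, chainWeight, chainVec,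
    Int.toNat_natCast]
  generalize r (Fin.last 0) = a
  generalize s (Fin.last 0) = b
  split_ifs with h
  · obtain ⟨d, rfl⟩ := Nat.exists_eq_add_of_le h.1
    rw [Nat.sub_zero, Nat.add_sub_cancel_left, gaussBinom_symm]
    simp only [mul_one, one_div]
    ring
  · rw [gaussBinom_eq_zero q (show a < b by omega)]
    simp

theorem seqTerm_snoc {t q : K} (ht : t ≠ 0) (hq : q ≠ 0) (k : ℕ) (r s : Fin (k + 1) → ℕ)
    (a b : ℕ) : seqTerm (k + 1 + 1) t q (Fin.snoc r a) (Fin.snoc s b) =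
      chainWeight t q a b * recipPoch q ((a : ℤ) - r (Fin.last k)) *
        qBinom q ((a : ℤ) - s (Fin.last k)) ((a : ℤ) - b) * seqTerm (k + 1) t q r s := by
  have h1 : ∀ i ∈ Finset.Icc 1 (k + 1), ∀ (x : Fin (k + 1) → ℕ) (c : ℕ),
      seqEntry (Fin.snoc x c : Fin (k + 1 + 1) → ℕ) i = seqEntry x i := by
    intro i hi x c
    exact seqEntry_snoc x c (Finset.mem_Icc.mp hi).2
  have h1' : ∀ i ∈ Finset.Icc 1 (k + 1), ∀ (x : Fin (k + 1) → ℕ) (c : ℕ),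
      seqEntry (Fin.snoc x c : Fin (k + 1 + 1) → ℕ) (i - 1) = seqEntry x (i - 1) := by
    intro i hi x c
    exact seqEntry_snoc x c ((Nat.sub_le _ _).trans (Finset.mem_Icc.mp hi).2)
  have h2 : ∀ i ∈ Finset.Icc 2 (k + 1), i ∈ Finset.Icc 1 (k + 1) := by
    intro i hi
    rw [Finset.mem_Icc] at *
    omega
  have h3 : ∀ x : Fin (k + 1) → ℕ, ∀ c : ℕ,
      seqEntry (Fin.snoc x c : Fin (k + 1 + 1) → ℕ) (k + 1) = (x (Fin.last k) : ℤ) := by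
    intro x c
    rw [seqEntry_snoc x c le_rfl, seqEntry_last]
  have e1 : ∑ i ∈ Finset.Icc 1 (k + 1), (2 * seqEntry (Fin.snoc r a : Fin (k + 1 + 1) → ℕ) i -
      seqEntry (Fin.snoc s b : Fin (k + 1 + 1) → ℕ) i) =
      ∑ i ∈ Finset.Icc 1 (k + 1), (2 * seqEntry r i - seqEntry s i) :=
    Finset.sum_congr rfl fun i hi => by rw [h1 i hi, h1 i hi]
  have e2 : ∑ i ∈ Finset.Icc 1 (k + 1), (seqEntry (Fin.snoc r a : Fin (k + 1 + 1) → ℕ) i ^ 2 -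
      seqEntry (Fin.snoc r a : Fin (k + 1 + 1) → ℕ) i *
      seqEntry (Fin.snoc s b : Fin (k + 1 + 1) → ℕ) i +
      seqEntry (Fin.snoc s b : Fin (k + 1 + 1) → ℕ) i ^ 2) = ∑ i ∈ Finset.Icc 1 (k + 1),
      (seqEntry r i ^ 2 - seqEntry r i * seqEntry s i + seqEntry s i ^ 2) :=
    Finset.sum_congr rfl fun i hi => by rw [h1 i hi, h1 i hi]
  have e3 : ∏ i ∈ Finset.Icc 2 (k + 1), recipPoch q
      (seqEntry (Fin.snoc r a : Fin (k + 1 + 1) → ℕ) i -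
        seqEntry (Fin.snoc r a : Fin (k + 1 + 1) → ℕ) (i - 1)) =
      ∏ i ∈ Finset.Icc 2 (k + 1), recipPoch q (seqEntry r i - seqEntry r (i - 1)) :=
    Finset.prod_congr rfl fun i hi => by rw [h1 i (h2 i hi), h1' i (h2 i hi)]
  have e4 : ∏ i ∈ Finset.Icc 1 (k + 1), qBinom q
      (seqEntry (Fin.snoc r a : Fin (k + 1 + 1) → ℕ) i -
        seqEntry (Fin.snoc s b : Fin (k + 1 + 1) → ℕ) (i - 1))
      (seqEntry (Fin.snoc r a : Fin (k + 1 + 1) → ℕ) i -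
        seqEntry (Fin.snoc s b : Fin (k + 1 + 1) → ℕ) i) = ∏ i ∈ Finset.Icc 1 (k + 1),
      qBinom q (seqEntry r i - seqEntry s (i - 1)) (seqEntry r i - seqEntry s i) :=
    Finset.prod_congr rfl fun i hi => by rw [h1 i hi, h1 i hi, h1' i hi]
  rw [seqTerm, seqTerm, Finset.sum_Icc_succ_top (show 1 ≤ k + 1 + 1 by omega),
    Finset.sum_Icc_succ_top (show 1 ≤ k + 1 + 1 by omega),
    Finset.prod_Icc_succ_top (show 2 ≤ k + 1 + 1 by omega),
    Finset.prod_Icc_succ_top (show 1 ≤ k + 1 + 1 by omega), e1, e2, e3, e4,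
    seqEntry_snoc_last, seqEntry_snoc_last, Nat.add_sub_cancel, h3, h3,
    seqEntry_snoc r a (show 1 ≤ k + 1 by omega), seqEntry_snoc s b (show 1 ≤ k + 1 by omega),
    zpow_add₀ ht, zpow_add₀ hq, chainWeight]
  ring

theorem sum_piFinset_snoc {M : Type*} [AddCommMonoid M] {k : ℕ} (S : Finset ℕ)
    (f : (Fin (k + 1) → ℕ) → M) :
    ∑ x ∈ Fintype.piFinset (fun _ : Fin (k + 1) => S), f x =
      ∑ a ∈ S, ∑ x ∈ Fintype.piFinset (fun _ : Fin k => S), f (Fin.snoc x a) := by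
  rw [← Finset.sum_product']
  refine Finset.sum_nbij' (fun x => (x (Fin.last k), Fin.init x))
    (fun p => (Fin.snoc p.2 p.1 : Fin (k + 1) → ℕ)) ?_ ?_ ?_ ?_ ?_
  · intro x hx
    rw [Fintype.mem_piFinset] at hx
    rw [Finset.mem_product, Fintype.mem_piFinset]
    exact ⟨hx _, fun i => hx _⟩
  · intro p hp
    rw [Finset.mem_product, Fintype.mem_piFinset] at hp
    rw [Fintype.mem_piFinset]
    intro i
    refine Fin.lastCases ?_ (fun j => ?_) i
    · rw [Fin.snoc_last (α := fun _ => ℕ)]; exact hp.1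
    · rw [Fin.snoc_castSucc (α := fun _ => ℕ)]; exact hp.2 j
  · intro x _
    exact Fin.snoc_init_self x
  · intro p _
    simp only [Fin.snoc_last (α := fun _ => ℕ), Fin.init_snoc (α := fun _ => ℕ)]
  · intro x _
    simp only [Fin.snoc_init_self]

/-- The weight `g` on the last entries is arbitrary so that the induction can peel them off and
absorb their coupling to the preceding entries into a new weight. -/
theorem sum_seqTerm {t q : K} (ht : t ≠ 0) (hq : q ≠ 0) {N : ℕ} (hN : qPoch q q N ≠ 0) (k : ℕ)
    (g : ℕ → ℕ → K) :
    ∑ r ∈ Fintype.piFinset (fun _ : Fin (k + 1) => Finset.range (N + 1)),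
      ∑ s ∈ Fintype.piFinset (fun _ : Fin (k + 1) => Finset.range (N + 1)),
      g (r (Fin.last k)) (s (Fin.last k)) * seqTerm (k + 1) t q r s =
    ∑ a ∈ Finset.range (N + 1), ∑ b ∈ Finset.range (N + 1),
      g a b * (chainWeight t q a b * chainVec t q k a b) := by
  induction k generalizing g with
  | zero =>
    rw [sum_piFinset_snoc]
    refine Finset.sum_congr rfl fun a ha => ?_
    have ha' := Nat.lt_succ_iff.mp (Finset.mem_range.mp ha)
    rw [Fintype.piFinset_of_isEmpty, Finset.univ_unique, Finset.sum_singleton, sum_piFinset_snoc]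
    refine Finset.sum_congr rfl fun b hb => ?_
    rw [Fintype.piFinset_of_isEmpty, Finset.univ_unique, Finset.sum_singleton,
      seqTerm_one hN _ _ (by rwa [Fin.snoc_last (α := fun _ => ℕ)])]
    simp only [Fin.snoc_last (α := fun _ => ℕ)]
  | succ k ih =>
    rw [sum_piFinset_snoc]
    refine Finset.sum_congr rfl fun a ha => ?_
    have ha' := Nat.lt_succ_iff.mp (Finset.mem_range.mp ha)
    simp only [sum_piFinset_snoc (k := k + 1)]
    rw [Finset.sum_comm]
    refine Finset.sum_congr rfl fun b hb => ?_
    have hb' := Nat.lt_succ_iff.mp (Finset.mem_range.mp hb)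
    simp only [Fin.snoc_last (α := fun _ => ℕ), seqTerm_snoc ht hq, ← mul_assoc]
    refine (ih fun c d => g a b * chainWeight t q a b * recipPoch q ((a : ℤ) - c) *
      qBinom q ((a : ℤ) - d) ((a : ℤ) - b)).trans ?_
    rw [chainVec]
    -- For b > a the original `q`-binomial vanishes. `chainVec` needs an explicit guard there, since
    -- the truncated a - b = 0 would make its binomial 1.
    split_ifs with hba
    swap
    · rw [mul_zero]
      refine Finset.sum_eq_zero fun c _ => Finset.sum_eq_zero fun d _ => ?_
      rw [qBinom_sub (qPoch_ne_zero_of_le hN ha'), if_neg (fun h => hba h.1)]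
      simp
    rw [Finset.mul_sum]
    refine (Finset.sum_subset (Finset.range_mono (show a + 1 ≤ N + 1 by omega)) ?_).symm.trans ?_
    · intro c _ hc
      refine Finset.sum_eq_zero fun d _ => ?_
      rw [recipPoch_sub, if_neg (by simpa using hc)]
      simp
    refine Finset.sum_congr rfl fun c hc => ?_
    have hc' := Nat.lt_succ_iff.mp (Finset.mem_range.mp hc)
    rw [Finset.mul_sum]
    refine (Finset.sum_subset (Finset.range_mono (show b + 1 ≤ N + 1 by omega)) ?_).symm.trans ?_
    · intro d _ hd
      rw [qBinom_sub (qPoch_ne_zero_of_le hN ha'), if_neg (by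
        rintro ⟨-, h⟩
        exact hd (Finset.mem_range.mpr (by omega)))]
      simp
    refine Finset.sum_congr rfl fun d hd => ?_
    have hd' := Nat.lt_succ_iff.mp (Finset.mem_range.mp hd)
    rw [qBinom_sub (qPoch_ne_zero_of_le hN ha'), if_pos ⟨hba, hd'⟩, recipPoch_sub, if_pos hc']
    ring

/-- The vanishing conventions enforce monotonicity, of r through the reciprocal Pochhammer symbols
and of s through the `q`-binomials. The sum may therefore run over all sequences in a box. -/
theorem seqTerm_monotone {k : ℕ} {t q : K} {r s : Fin (k + 1) → ℕ}
    (h : seqTerm (k + 1) t q r s ≠ 0) : Monotone r ∧ Monotone s := by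
  have h1 := right_ne_zero_of_mul h
  have h2 := right_ne_zero_of_mul (left_ne_zero_of_mul (left_ne_zero_of_mul
    (left_ne_zero_of_mul h)))
  rw [Finset.prod_ne_zero_iff] at h1 h2
  have e1 : ∀ (x : Fin (k + 1) → ℕ) (i : Fin k), seqEntry x (i + 1) = (x i.castSucc : ℤ) :=
    fun x i => seqEntry_add_one x _
  have e2 : ∀ (x : Fin (k + 1) → ℕ) (i : Fin k), seqEntry x (i + 1 + 1) = (x i.succ : ℤ) :=
    fun x i => seqEntry_add_one x (Nat.succ_lt_succ i.isLt)
  constructor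
  · rw [Fin.monotone_iff_le_succ]
    intro i
    have h3 := h2 (i + 1 + 1) (Finset.mem_Icc.mpr ⟨by omega, by omega⟩)
    rw [Nat.add_sub_cancel, e1, e2, recipPoch_sub] at h3
    by_contra hn
    exact h3 (if_neg hn)
  · rw [Fin.monotone_iff_le_succ]
    intro i
    have h3 := h1 (i + 1 + 1) (Finset.mem_Icc.mpr ⟨by omega, by omega⟩)
    rw [Nat.add_sub_cancel, e1, e2, e2, qBinom] at h3
    by_contra hn
    exact h3 (if_neg (by omega))

theorem ZSum_eq_sum (k N : ℕ) (t q : K) : ZSum (k + 1) N t q =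
    ∑ r ∈ Fintype.piFinset (fun _ : Fin (k + 1) => Finset.range (N + 1)),
      ∑ s ∈ Fintype.piFinset (fun _ : Fin (k + 1) => Finset.range (N + 1)),
      recipPoch q ((N : ℤ) - r (Fin.last k)) * seqTerm (k + 1) t q r s := by
  let φ : (Fin (k + 1) →o ℕ) × (Fin (k + 1) →o ℕ) → (Fin (k + 1) → ℕ) × (Fin (k + 1) → ℕ) :=
    fun p => (p.1, p.2)
  let G : (Fin (k + 1) → ℕ) × (Fin (k + 1) → ℕ) → K := fun p =>
    recipPoch q ((N : ℤ) - p.1 (Fin.last k)) * seqTerm (k + 1) t q p.1 p.2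
  have hinj : Function.Injective φ := fun p p' h => by
    rw [Prod.mk.injEq] at h
    exact Prod.ext (DFunLike.coe_injective h.1) (DFunLike.coe_injective h.2)
  have hG : ∀ p, ZTerm (k + 1) N t q p.1 p.2 = G (φ p) := fun p => by
    rw [ZTerm_eq, seqEntry_last]
  have hsupp : ∀ p ∈ Function.support G, p ∈ Set.range φ := fun p hp => by
    have hm := seqTerm_monotone (right_ne_zero_of_mul hp)
    exact ⟨(⟨p.1, hm.1⟩, ⟨p.2, hm.2⟩), rfl⟩
  rw [← Finset.sum_product', ZSum]
  simp only [hG]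
  -- Pairs of monotone maps embed into pairs of functions, and the support lies in the image, so the
  -- restriction can be dropped.
  rw [← finsum_mem_range hinj, finsum_mem_inter_support_eq' G _ Set.univ
    fun p hp => iff_of_true (hsupp p hp) trivial, finsum_mem_univ]
  refine finsum_eq_finsetSum_of_support_subset G fun p hp => ?_
  obtain ⟨p', rfl⟩ := hsupp p hp
  have hb := ZTerm_bound (k + 1) N t q p'.1 p'.2 (by rw [hG]; exact hp)
  simp only [Finset.coe_product, Set.mem_prod, Finset.mem_coe, Fintype.mem_piFinset,
    Finset.mem_range]
  exact ⟨fun i => Nat.lt_succ_of_le (hb i).1,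
    fun i => Nat.lt_succ_of_le ((hb i).2.trans (hb i).1)⟩

/-- One further rank-two step with both last entries equal to N reproduces the sum: its binomial has
lower index 0 and only 1/(q;q)_(N-r_k) remains. -/
theorem ZSum_succ {t q : K} (ht : t ≠ 0) (hq : q ≠ 0) {N : ℕ} (hN : qPoch q q N ≠ 0)
    (hT : qPoch (t * q) q N ≠ 0) (k : ℕ) :
    ZSum (k + 1) N t q = baileyIter t q (k + 1) N / qPoch (t * q) q N := by
  rw [ZSum_eq_sum, sum_seqTerm ht hq hN k (fun a _ => recipPoch q ((N : ℤ) - a)),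
    ← chainVec_self ht hq hN hT, chainVec, if_pos le_rfl]
  refine Finset.sum_congr rfl fun a ha => Finset.sum_congr rfl fun b _ => ?_
  rw [recipPoch_sub, if_pos (Nat.lt_succ_iff.mp (Finset.mem_range.mp ha)), Nat.sub_self,
    gaussBinom_zero_right]
  ring

end Sum

/-! ### The theorem -/

theorem mainTheorem6 {K : Type*} [Field K] (k N : ℕ) (hk : 1 ≤ k) (t q : K)
    (ht : t ≠ 0) (hq : q ≠ 0)
    (hq1 : ∀ j : ℕ, 1 ≤ j → j ≤ N → q ^ j ≠ 1)
    (htq : ∀ j : ℕ, j ≤ N → t * q ^ j ≠ 1) :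
    ZSum k N t q =
      (1 - t) ^ 2 * q ^ N * (t ^ (2 * N) * q ^ (N ^ 2)) ^ (k - 1) / (1 - t * q ^ N) ^ 2
        * ZSum k N (t⁻¹ * q ^ (-(N : ℤ))) q := by
  obtain ⟨k, rfl⟩ := Nat.exists_eq_add_of_le' hk
  have hN : qPoch q q N ≠ 0 := qPoch_ne_zero fun j hj => by
    rw [← pow_succ']
    exact hq1 _ (by omega) (by omega)
  -- The length N + 1 covers both 1 - t and 1 - tq^N.
  have hT : qPoch t q (N + 1) ≠ 0 := qPoch_ne_zero fun j hj => htq j (by omega)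
  have hT1 : qPoch (t * q) q N ≠ 0 := qPoch_ne_zero fun j hj => by
    rw [mul_assoc, ← pow_succ']
    exact htq _ (by omega)
  have ht' : t⁻¹ * q ^ (-(N : ℤ)) ≠ 0 := mul_ne_zero (inv_ne_zero ht) (zpow_ne_zero _ hq)
  -- A zero t'q^(j+1) = 1 would mean tq^(N-j-1) = 1, so the reflected parameter is admissible too.
  have hT2 : qPoch (t⁻¹ * q ^ (-(N : ℤ)) * q) q N ≠ 0 := qPoch_ne_zero fun j hj h => by
    refine htq (N - (j + 1)) (Nat.sub_le _ _) ?_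
    obtain ⟨d, rfl⟩ := Nat.exists_eq_add_of_le (Nat.succ_le_of_lt hj)
    rw [zpow_neg, zpow_natCast, pow_add, pow_succ] at h
    rw [show j.succ + d - (j + 1) = d by omega]
    field_simp at h
    exact h.symm
  rw [ZSum_succ ht hq hN hT1, ZSum_succ ht' hq hN hT2, baileyIter_reflect_self ht hq hN hT,
    Nat.add_sub_cancel]
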